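/- Let $\rho,\theta,d:\mathbb{R}^2\to\mathbb{R}$ be smooth with $\rho>0$, and consider the two-level Hamiltonian with Weyl symbol $$H(p,q)=\tfrac12|p|^2 I+V(q)+d(q)I,\qquad V=\rho\begin{pmatrix}\cos\theta&\sin\theta\\ \sin\theta&-\cos\theta\end{pmatrix},\qquad (p,q)\in\mathbb{R}^2\times\mathbb{R}^2 .$$ Let $\#$ be the Moyal product (composition of Weyl symbols for $p\mapsto-i\varepsilon\nabla$) on formal power series in $\varepsilon$ whose coefficients are smooth matrix-valued symbols. Put $$\sigma_z=\begin{pmatrix}\cos\theta&\sin\theta\\ \sin\theta&-\cos\theta\end{pmatrix},\quad \sigma_x=\begin{pmatrix}\sin\theta&-\cos\theta\\-\cos\theta&-\sin\theta\end{pmatrix},\quad \sigma_y=\begin{pmatrix}0&-1\\1&0\end{pmatrix},\quad R=\begin{pmatrix}\cos\frac\theta2&\sin\frac\theta2\\-\sin\frac\theta2&\cos\frac\theta2\end{pmatrix}.$$ There is exactly one formal series $\pi=\sum_k\varepsilon^k\pi_k$ with $\pi_0=\frac12(I+\sigma_z)$, $\pi\#\pi=\pi$ and $H\#\pi=\pi\#H$;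 write $\pi_n=x_n\sigma_x+y_n\sigma_y+z_n\sigma_z+w_nI$. For $n\ge0$ an $n$-th superadiabatic representation is given by a series $U=\sum_k\varepsilon^kU_k$ with $U_0=R$, $U\#U^*=U^*\#U=I+O(\varepsilon^{n+2})$, and $U\#\big(\sum_{k\le n}\varepsilon^k\pi_k\big)\#U^*$ diagonal up to $O(\varepsilon^{n+2})$. Such $U$ exist for every $n$. For each of them $U\#H\#U^*$ has leading term $\mathrm{diag}\big(\frac12|p|^2+d+\rho,\ \frac12|p|^2+d-\rho\big)$; its off-diagonal entries vanish at the orders $0,\dots,n$; and at order $n+1$ its upper right entry $\kappa_{n+1}^+$ and lower left entry $\kappa_{n+1}^-$ are $$\kappa_{n+1}^\pm(p,q)=-2\rho(q)\big(x_{n+1}(p,q)\pm y_{n+1}(p,q)\big).$$ Moreover $$x_1=z_1=w_1=0,\qquad y_1=-\frac{i}{4\rho}\big(p_1\partial_{q_1}\theta+p_2\partial_{q_2}\theta\big),$$ and for $n\ge1$: $y_n=0$ if $n$ is even, $x_n=z_n=w_n=0$ if $n$ is odd. With the abbreviation $\displaystyle\mathcal S_n[F_{j,\alpha}]=\sum_{j=1}^n\frac1{(2i)^j\,j!}\sum_{|\alpha|=j}\frac{j!}{\alpha_1!\,\alpha_2!}\,\partial_p^\alpha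 F_{j,\alpha}$, for $n$ odd $$x_{n+1}=-\frac1{2\rho}\Big[\frac1i\,p\cdot\nabla_qy_n-2\,\mathcal S_n\big[b_\alpha z_{n+1-j}-a_\alpha x_{n+1-j}+c_\alpha y_{n+1-j}\big]\Big],$$ and for $n\ge2$ even $$y_{n+1}=-\frac1{2\rho}\Big[\frac1i\big(p\cdot\nabla_qx_n-z_n\,p\cdot\nabla_q\theta\big)-2\,\mathcal S_n\big[-a_\alpha y_{n+1-j}+b_\alpha w_{n+1-j}+c_\alpha x_{n+1-j}\big]\Big],$$ $$\frac1i\big(p\cdot\nabla_qz_n+x_n\,p\cdot\nabla_q\theta\big)=2\,\mathcal S_n\big[b_\alpha y_{n+1-j}+a_\alpha w_{n+1-j}+c_\alpha z_{n+1-j}\big],$$ $$\frac1i\,p\cdot\nabla_qw_n=2\,\mathcal S_n\big[a_\alpha z_{n+1-j}+b_\alpha x_{n+1-j}+c_\alpha w_{n+1-j}\big].$$ Here $c_\alpha=\partial_q^\alpha d$ (so the terms with $c_\alpha$ vanish when $d$ is constant), and $a_\alpha,b_\alpha$ are the functions of $q$ given by $a_0=\rho$, $b_0=0$ and, for $k=1,2$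 and $e_k$ the $k$-th unit multi-index, $$a_{\alpha+e_k}=\partial_{q_k}a_\alpha+(\partial_{q_k}\theta)\,b_\alpha,\qquad b_{\alpha+e_k}=\partial_{q_k}b_\alpha-(\partial_{q_k}\theta)\,a_\alpha .$$ -/

import Mathlib

open scoped ContDiff Nat Matrix

noncomputable section

/-- Position (or momentum) space `ℝ²`. -/
abbrev Plane : Type := Fin 2 → ℝ

/-- Phase space; a point is the pair `(p, q)` of momentum and position. -/
abbrev PhaseSpace : Type := Plane × Plane

/-- Scalar symbols: complex functions of `(p, q)`. -/
abbrev ScalarSymbol : Type := PhaseSpace → ℂ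

/-- `2 × 2` matrices of symbols. -/
abbrev MatSymbol : Type := Matrix (Fin 2) (Fin 2) ScalarSymbol

/-- Formal power series `∑ₖ εᵏ Aₖ` of matrix symbols, given by their coefficients. -/
abbrev SymbolSeries : Type := ℕ → MatSymbol

/-- `∂f/∂qᵢ` for a real function on position space. -/
def posDeriv (i : Fin 2) (f : Plane → ℝ) : Plane → ℝ :=
  fun q => fderiv ℝ f q (Pi.single i 1)

/-- `∂a/∂pᵢ` for a symbol. -/
def dp (i : Fin 2) (a : ScalarSymbol) : ScalarSymbol :=
  fun z => fderiv ℝ a z (Pi.single i 1, 0)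

/-- `∂a/∂qᵢ` for a symbol. -/
def dq (i : Fin 2) (a : ScalarSymbol) : ScalarSymbol :=
  fun z => fderiv ℝ a z (0, Pi.single i 1)

/-- `∂_p^α` for a multi-index `α = (α₁, α₂)`. -/
def dpMulti (α : ℕ × ℕ) (a : ScalarSymbol) : ScalarSymbol :=
  (dp 0)^[α.1] ((dp 1)^[α.2] a)

/-- `∂_q^α` for a multi-index `α = (α₁, α₂)`. -/
def dqMulti (α : ℕ × ℕ) (a : ScalarSymbol) : ScalarSymbol :=
  (dq 0)^[α.1] ((dq 1)^[α.2] a)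

/-- A real function of position, as a symbol. -/
def onQ (f : Plane → ℝ) : ScalarSymbol := fun z => (f z.2 : ℂ)

/-- The kinetic energy `|p|² / 2`. -/
def kinetic : ScalarSymbol := fun z => ((∑ i, z.1 i ^ 2 : ℝ) : ℂ) / 2

/-- `p · ∇_q a`. -/
def transport (a : ScalarSymbol) : ScalarSymbol := fun z => ∑ i, (z.1 i : ℂ) * dq i a z

/-- The coefficient of `ε^l` in the Moyal product
`a # b = exp ((ε / 2i) (∂_p ⊗ ∂_q - ∂_q ⊗ ∂_p)) (a ⊗ b)`, i.e. the composition law of Weyl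
symbols for the quantization `q ↦ x`, `p ↦ -i ε ∂_x`. -/
def moyalTerm (l : ℕ) (a b : ScalarSymbol) : ScalarSymbol :=
  (1 / (2 * Complex.I) ^ l : ℂ) •
    ∑ ν ∈ Finset.HasAntidiagonal.antidiagonal l,
      ∑ α ∈ Finset.HasAntidiagonal.antidiagonal ν.1, ∑ β ∈ Finset.HasAntidiagonal.antidiagonal ν.2,
        ((-1) ^ ν.2 / (α.1 ! * α.2 ! * β.1 ! * β.2 ! : ℂ)) •
          (dpMulti α (dqMulti β a) * dqMulti α (dpMulti β b))

/-- The coefficient of `ε^l` in the Moyal product of two matrix symbols. -/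
def moyalMat (l : ℕ) (A B : MatSymbol) : MatSymbol :=
  Matrix.of fun i j => ∑ s, moyalTerm l (A i s) (B s j)

/-- The Moyal product of two formal series of matrix symbols. -/
def starProd (A B : SymbolSeries) : SymbolSeries := fun n =>
  ∑ u ∈ Finset.HasAntidiagonal.antidiagonal n, ∑ v ∈ Finset.HasAntidiagonal.antidiagonal u.2, moyalMat u.1 (A v.1) (B v.2)

/-- The series with the single term `A` at order zero. -/
def constSeries (A : MatSymbol) : SymbolSeries := fun k => if k = 0 then A else 0

/-- The adjoint of a series (`ε` is real; adjoints of Weyl symbols are taken pointwise). -/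
def adjSeries (A : SymbolSeries) : SymbolSeries := fun k => (A k)ᴴ

/-- The partial sum `∑_{k ≤ n} εᵏ Aₖ`. -/
def truncSeries (n : ℕ) (A : SymbolSeries) : SymbolSeries := fun k => if k ≤ n then A k else 0

/-- `σ_z(q) = V(q) / ρ(q)`. -/
def sigmaZ (θ : Plane → ℝ) : MatSymbol :=
  !![onQ fun q => Real.cos (θ q), onQ fun q => Real.sin (θ q);
     onQ fun q => Real.sin (θ q), onQ fun q => -Real.cos (θ q)]

/-- `σ_x(q)`, the first Pauli matrix carried by the adiabatic frame. -/
def sigmaX (θ : Plane → ℝ) : MatSymbol :=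
  !![onQ fun q => Real.sin (θ q), onQ fun q => -Real.cos (θ q);
     onQ fun q => -Real.cos (θ q), onQ fun q => -Real.sin (θ q)]

/-- `σ_y`, normalized to be real antisymmetric, so that `σ_z σ_x = σ_y`. -/
def sigmaY : MatSymbol := !![0, -1; 1, 0]

/-- The matrix symbol `x σ_x + y σ_y + z σ_z + w 1`, order by order. -/
def frameSeries (θ : Plane → ℝ) (x y z w : ℕ → ScalarSymbol) : SymbolSeries := fun n =>
  Matrix.of fun i j =>
    x n * sigmaX θ i j + y n * sigmaY i j + z n * sigmaZ θ i j + w n * (1 : MatSymbol) i j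

/-- The symbol `|p|²/2 + V(q) + d(q)` of the Hamiltonian, with
`V = ρ (cos θ, sin θ; sin θ, -cos θ)`. -/
def hamiltonian (ρ θ d : Plane → ℝ) : MatSymbol :=
  !![kinetic + onQ d + onQ fun q => ρ q * Real.cos (θ q), onQ fun q => ρ q * Real.sin (θ q);
     onQ fun q => ρ q * Real.sin (θ q), kinetic + onQ d - onQ fun q => ρ q * Real.cos (θ q)]

/-- The adiabatic frame: the rotation by `θ/2`, which diagonalizes `V(q)`. -/
def adiabaticFrame (θ : Plane → ℝ) : MatSymbol :=
  !![onQ fun q => Real.cos (θ q / 2), onQ fun q => Real.sin (θ q / 2);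
     onQ fun q => -Real.sin (θ q / 2), onQ fun q => Real.cos (θ q / 2)]

/-- The formal superadiabatic projection `π = ∑ₖ εᵏ πₖ` of the upper level: a formal projection
that commutes with the Hamiltonian and whose principal symbol is the spectral projection of
`V(q)` for the eigenvalue `ρ(q)`. -/
structure IsSuperadiabaticProjection (ρ θ d : Plane → ℝ) (π : SymbolSeries) : Prop where
  smooth : ∀ k i j, ContDiff ℝ ∞ (π k i j)
  principal : π 0 = (1 / 2 : ℂ) • (1 + sigmaZ θ)
  idempotent : starProd π π = π
  commutes : starProd (constSeries (hamiltonian ρ θ d)) π =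
    starProd π (constSeries (hamiltonian ρ θ d))

/-- `U` is (the symbol of) a transformation to the `n`-th superadiabatic representation: starting
from the adiabatic frame, unitary up to `O(ε^(n+2))`, and such that it block-diagonalizes the
`n`-th superadiabatic projection `∑_{k ≤ n} εᵏ πₖ` up to `O(ε^(n+2))`. -/
structure IsSuperadiabaticUnitary (θ : Plane → ℝ) (π : SymbolSeries) (n : ℕ)
    (U : SymbolSeries) : Prop where
  smooth : ∀ k i j, ContDiff ℝ ∞ (U k i j)
  principal : U 0 = adiabaticFrame θ
  mul_adj : ∀ k ≤ n + 1, starProd U (adjSeries U) k = constSeries 1 k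
  adj_mul : ∀ k ≤ n + 1, starProd (adjSeries U) U k = constSeries 1 k
  diagonalizes : ∀ k ≤ n + 1, ∀ i j, i ≠ j →
    starProd (starProd U (truncSeries n π)) (adjSeries U) k i j = 0

/-- The symbol `U # H # U*` of the Hamiltonian in the representation given by `U`. -/
def transformedHamiltonian (ρ θ d : Plane → ℝ) (U : SymbolSeries) : SymbolSeries :=
  starProd (starProd U (constSeries (hamiltonian ρ θ d))) (adjSeries U)

/-- The recursions for `a_α` and `b_α`. -/
structure CoefficientRecursion (ρ θ : Plane → ℝ) (a b : ℕ × ℕ → Plane → ℝ) : Prop where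
  a_zero : a (0, 0) = ρ
  b_zero : b (0, 0) = 0
  a_succ_left : ∀ α₁ α₂, a (α₁ + 1, α₂) =
    posDeriv 0 (a (α₁, α₂)) + posDeriv 0 θ * b (α₁, α₂)
  b_succ_left : ∀ α₁ α₂, b (α₁ + 1, α₂) =
    posDeriv 0 (b (α₁, α₂)) - posDeriv 0 θ * a (α₁, α₂)
  a_succ_right : ∀ α₁ α₂, a (α₁, α₂ + 1) =
    posDeriv 1 (a (α₁, α₂)) + posDeriv 1 θ * b (α₁, α₂)
  b_succ_right : ∀ α₁ α₂, b (α₁, α₂ + 1) =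
    posDeriv 1 (b (α₁, α₂)) - posDeriv 1 θ * a (α₁, α₂)

/-- `c_α = ∂_q^α d`. -/
def traceCoeff (d : Plane → ℝ) (α : ℕ × ℕ) : Plane → ℝ :=
  (posDeriv 0)^[α.1] ((posDeriv 1)^[α.2] d)

/-- `∑_{j=1}^n (1 / ((2i)^j j!)) ∑_{|α|=j} (j! / (α₁! α₂!)) ∂_p^α F(j, α)`. -/
def momentumSum (n : ℕ) (F : ℕ → ℕ × ℕ → ScalarSymbol) : ScalarSymbol :=
  ∑ j ∈ Finset.Icc 1 n, (1 / ((2 * Complex.I) ^ j * j !) : ℂ) •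
    ∑ α ∈ Finset.HasAntidiagonal.antidiagonal j, (j.choose α.1 : ℂ) • dpMulti α (F j α)

end

/-! On smooth symbols the coefficients m_n of the Moyal product obey (n+1) m_{n+1}(a,b) = (1/2i) Σ_i
(m_n(∂_{p_i}a, ∂_{q_i}b) − m_n(∂_{q_i}a, ∂_{p_i}b)), which is the differential equation of the
exponential defining the product. Associativity (`moyal_assoc`) and the behaviour under exchange of
factors (`moyal_swap`) follow by induction. Formal series therefore form a ring with two
anti-automorphisms: complex conjugation, and the substitution ε ↦ −ε. Combined with transposition,
both pass to 2×2 matrices, and the problem becomes perturbation theory in a ring filtered by powers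
of ε, where leading coefficients multiply pointwise.

A self-adjoint series with gapped leading term is diagonalized order by order: a correction 1 + ε^k
C restores unitarity through its self-adjoint part and removes the off-diagonal entries through its
skew part, which is found by dividing by the gap (`exists_diagonalizing_unitary`). Applied to H, and
after transporting diag(1,0) back, this yields approximate projections; applied to the truncation of
π, it yields the superadiabatic unitaries. Two projections with the same principal symbol agree,
because the first coefficient X of their difference commutes with π_0 and satisfies X = π_0 X + X
π_0, hence vanishes. Uniqueness glues the approximate projections into π. It also makes π invariant
under transposition with ε ↦ −ε, which is the parity statement: π_n is symmetric for n even and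
antisymmetric for n odd.

For the coupling, let T be the truncation of π at order n. Since [H, T] = −[H, π − T], conjugation
by U shows that the commutator of UHU* with the nearly diagonal UTU* starts at order n+1 with
−R[H_0, π_{n+1}]R*; its off-diagonal entries determine those of UHU* (`offDiagonal_conj`). For the
recursions, order n+1 of [H, π] = 0 is expanded. The kinetic energy contributes exactly (1/i) p·∇_q
π_n. The l-th Moyal coefficient with the potential gives commutators for even l and anticommutators
for odd l (`signed_commutator`). Reading components in the rotating frame and using parity gives the
four equations. -/

noncomputable section

/-! ### Smooth symbols and their derivatives -/

/-- The algebra of smooth scalar symbols. -/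
def smoothSymbols : Subalgebra ℂ ScalarSymbol where
  carrier := {a | ContDiff ℝ ∞ a}
  mul_mem' {_ _} ha hb := ContDiff.mul (show ContDiff ℝ ∞ _ from ha) (show ContDiff ℝ ∞ _ from hb)
  add_mem' {_ _} ha hb := ContDiff.add (show ContDiff ℝ ∞ _ from ha) (show ContDiff ℝ ∞ _ from hb)
  algebraMap_mem' c := (contDiff_const : ContDiff ℝ ∞ fun _ : PhaseSpace => c)

/-- Smooth scalar symbols. -/
def SmoothSymbol : Type := smoothSymbols

instance : CommRing SmoothSymbol := inferInstanceAs (CommRing smoothSymbols)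

instance : Algebra ℂ SmoothSymbol := inferInstanceAs (Algebra ℂ smoothSymbols)

/-- The inclusion of the smooth symbols into all symbols. -/
def SmoothSymbol.val : SmoothSymbol →ₐ[ℂ] ScalarSymbol := smoothSymbols.val

instance : CoeOut SmoothSymbol ScalarSymbol := ⟨fun a => SmoothSymbol.val a⟩

lemma SmoothSymbol.val_injective : Function.Injective SmoothSymbol.val := Subtype.val_injective

@[ext]
lemma SmoothSymbol.ext {a b : SmoothSymbol} (h : ∀ z, (a : ScalarSymbol) z = (b : ScalarSymbol) z) :
    a = b :=
  SmoothSymbol.val_injective (funext h)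

/-- A smooth function on phase space as a smooth symbol. -/
def SmoothSymbol.mk (a : ScalarSymbol) (ha : ContDiff ℝ ∞ a) : SmoothSymbol := ⟨a, ha⟩

@[simp]
lemma SmoothSymbol.coe_mk (a : ScalarSymbol) (ha : ContDiff ℝ ∞ a) :
    (SmoothSymbol.mk a ha : ScalarSymbol) = a := rfl

lemma SmoothSymbol.contDiff (a : SmoothSymbol) : ContDiff ℝ ∞ (a : ScalarSymbol) := a.2

lemma SmoothSymbol.differentiable (a : SmoothSymbol) : Differentiable ℝ (a : ScalarSymbol) :=
  a.contDiff.differentiable (by simp)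

/-- The directional derivative of smooth symbols. -/
def directional (v : PhaseSpace) : SmoothSymbol →ₗ[ℂ] SmoothSymbol where
  toFun a := .mk (fun z => fderiv ℝ (a : ScalarSymbol) z v)
    ((a.contDiff.fderiv_right (m := ∞) (by simp)).clm_apply contDiff_const)
  map_add' a b := by
    ext z
    change fderiv ℝ ((a : ScalarSymbol) + (b : ScalarSymbol)) z v = _
    rw [fderiv_add (a.differentiable z) (b.differentiable z)]
    rfl
  map_smul' c a := by
    ext z
    change fderiv ℝ (c • (a : ScalarSymbol)) z v = _
    rw [fderiv_const_smul (a.differentiable z)]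
    rfl

lemma directional_mul (v : PhaseSpace) (a b : SmoothSymbol) :
    directional v (a * b) = directional v a * b + a * directional v b := by
  ext z
  change fderiv ℝ ((a : ScalarSymbol) * (b : ScalarSymbol)) z v = _
  rw [fderiv_mul (a.differentiable z) (b.differentiable z)]
  simp [directional]
  ring

lemma directional_one (v : PhaseSpace) : directional v 1 = 0 := by
  have h := directional_mul v 1 1
  simpa using h

lemma directional_comm (v w : PhaseSpace) (a : SmoothSymbol) :
    directional v (directional w a) = directional w (directional v a) := by
  ext z
  have hd : DifferentiableAt ℝ (fderiv ℝ (a : ScalarSymbol)) z :=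
    (a.contDiff.fderiv_right (m := ∞) (by simp)).differentiable (by simp) z
  have key : ∀ u t : PhaseSpace,
      fderiv ℝ (fun y => fderiv ℝ (a : ScalarSymbol) y u) z t =
        fderiv ℝ (fderiv ℝ (a : ScalarSymbol)) z t u := by
    intro u t
    rw [fderiv_clm_apply hd (differentiableAt_const u)]
    simp
  change fderiv ℝ (fun y => fderiv ℝ (a : ScalarSymbol) y w) z v =
    fderiv ℝ (fun y => fderiv ℝ (a : ScalarSymbol) y v) z w
  rw [key, key]
  exact (a.contDiff.contDiffAt.isSymmSndFDerivAt (by simpa using ENat.LEInfty.out)).eq v w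

/-- `∂/∂pᵢ` on smooth symbols. -/
def derivP (i : Fin 2) : SmoothSymbol →ₗ[ℂ] SmoothSymbol := directional (Pi.single i 1, 0)

/-- `∂/∂qᵢ` on smooth symbols. -/
def derivQ (i : Fin 2) : SmoothSymbol →ₗ[ℂ] SmoothSymbol := directional (0, Pi.single i 1)

lemma coe_derivP (i : Fin 2) (a : SmoothSymbol) : (derivP i a : ScalarSymbol) = dp i a := rfl

lemma coe_derivQ (i : Fin 2) (a : SmoothSymbol) : (derivQ i a : ScalarSymbol) = dq i a := rfl

lemma derivP_derivP (i j : Fin 2) (a : SmoothSymbol) :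
    derivP i (derivP j a) = derivP j (derivP i a) := directional_comm _ _ _

lemma derivQ_derivQ (i j : Fin 2) (a : SmoothSymbol) :
    derivQ i (derivQ j a) = derivQ j (derivQ i a) := directional_comm _ _ _

lemma derivP_derivQ (i j : Fin 2) (a : SmoothSymbol) :
    derivP i (derivQ j a) = derivQ j (derivP i a) := directional_comm _ _ _

/-! ### Moyal coefficients by recursion: associativity and symmetry -/

/-- The coefficients of the Moyal product, through the recursion obtained by differentiating
`exp ((ε / 2i) (∂_p ⊗ ∂_q - ∂_q ⊗ ∂_p))` in `ε`. -/
def moyal : ℕ → SmoothSymbol →ₗ[ℂ] SmoothSymbol →ₗ[ℂ] SmoothSymbol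
  | 0 => LinearMap.mul ℂ SmoothSymbol
  | n + 1 => (1 / (2 * Complex.I * ((n : ℂ) + 1))) •
      ∑ i, ((moyal n).compl₁₂ (derivP i) (derivQ i) - (moyal n).compl₁₂ (derivQ i) (derivP i))

lemma moyal_zero (a b : SmoothSymbol) : moyal 0 a b = a * b := rfl

lemma moyal_succ (n : ℕ) (a b : SmoothSymbol) :
    moyal (n + 1) a b = (1 / (2 * Complex.I * ((n : ℂ) + 1))) •
      ∑ i, (moyal n (derivP i a) (derivQ i b) - moyal n (derivQ i a) (derivP i b)) := by
  simp only [moyal, LinearMap.smul_apply, LinearMap.sum_apply, LinearMap.sub_apply,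
    LinearMap.compl₁₂_apply]

lemma succ_smul_moyal_succ (n : ℕ) (a b : SmoothSymbol) :
    ((n : ℂ) + 1) • moyal (n + 1) a b = (1 / (2 * Complex.I)) •
      ∑ i, (moyal n (derivP i a) (derivQ i b) - moyal n (derivQ i a) (derivP i b)) := by
  rw [moyal_succ, smul_smul]
  congr 1
  have : (n : ℂ) + 1 ≠ 0 := Nat.cast_add_one_ne_zero n
  field_simp

/-- A constant vector field commutes with every `derivP` and `derivQ`, so its Leibniz rule survives
each step of the recursion. In associativity this distributes an outer derivative over an inner
Moyal product. -/
lemma directional_moyal (v : PhaseSpace) (n : ℕ) (a b : SmoothSymbol) :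
    directional v (moyal n a b) = moyal n (directional v a) b + moyal n a (directional v b) := by
  induction n generalizing a b with
  | zero => exact directional_mul v a b
  | succ n ih =>
    simp only [moyal_succ, map_smul, map_sum, map_sub, ih, ← smul_add, ← Finset.sum_add_distrib]
    congr 1
    refine Finset.sum_congr rfl fun i _ => ?_
    simp only [derivP, derivQ, directional_comm _ v]
    abel

lemma derivP_moyal (i : Fin 2) (n : ℕ) (a b : SmoothSymbol) :
    derivP i (moyal n a b) = moyal n (derivP i a) b + moyal n a (derivP i b) :=
  directional_moyal _ _ _ _

lemma derivQ_moyal (i : Fin 2) (n : ℕ) (a b : SmoothSymbol) :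
    derivQ i (moyal n a b) = moyal n (derivQ i a) b + moyal n a (derivQ i b) :=
  directional_moyal _ _ _ _

/-- On the antidiagonal of l + 1 the factor l + 1 is the sum of the two indices, and each summand
absorbs one of them. This is the product rule for generating functions, in the form that matches
`succ_smul_moyal_succ`. -/
lemma sum_antidiagonal_succ_smul {M : Type*} [AddCommGroup M] [Module ℂ M] (u : ℕ → ℕ → M)
    (l : ℕ) :
    ((l : ℂ) + 1) • ∑ ν ∈ Finset.HasAntidiagonal.antidiagonal (l + 1), u ν.1 ν.2 =
      ∑ ν ∈ Finset.HasAntidiagonal.antidiagonal l, ((ν.1 : ℂ) + 1) • u (ν.1 + 1) ν.2 +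
      ∑ ν ∈ Finset.HasAntidiagonal.antidiagonal l, ((ν.2 : ℂ) + 1) • u ν.1 (ν.2 + 1) := by
  have h : ((l : ℂ) + 1) • ∑ ν ∈ Finset.HasAntidiagonal.antidiagonal (l + 1), u ν.1 ν.2 =
      ∑ ν ∈ Finset.HasAntidiagonal.antidiagonal (l + 1), (ν.1 : ℂ) • u ν.1 ν.2 +
      ∑ ν ∈ Finset.HasAntidiagonal.antidiagonal (l + 1), (ν.2 : ℂ) • u ν.1 ν.2 := by
    rw [Finset.smul_sum, ← Finset.sum_add_distrib]
    refine Finset.sum_congr rfl fun ν hν => ?_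
    rw [← add_smul]
    congr 1
    exact_mod_cast (Finset.HasAntidiagonal.mem_antidiagonal.mp hν).symm
  rw [h, Finset.Nat.sum_antidiagonal_succ, Finset.Nat.sum_antidiagonal_succ']
  simp

/-- Both triple products solve the same differential equation in ε: multiplying order n + 1 by n + 1
brings out the bidifferential operator acting on the pairs (a,b), (a,c) and (b,c), whichever way the
factors are bracketed. What remains is order n with differentiated arguments, where induction
applies. -/
lemma moyal_assoc (n : ℕ) (a b c : SmoothSymbol) :
    ∑ k ∈ Finset.HasAntidiagonal.antidiagonal n, moyal k.1 (moyal k.2 a b) c =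
      ∑ k ∈ Finset.HasAntidiagonal.antidiagonal n, moyal k.1 a (moyal k.2 b c) := by
  induction n generalizing a b c with
  | zero => simp [moyal_zero, mul_assoc]
  | succ n ih =>
    have hn : (n : ℂ) + 1 ≠ 0 := Nat.cast_add_one_ne_zero n
    refine smul_right_injective _ hn ?_
    change ((n : ℂ) + 1) • _ = ((n : ℂ) + 1) • _
    rw [sum_antidiagonal_succ_smul (fun i j => moyal i (moyal j a b) c),
      sum_antidiagonal_succ_smul (fun i j => moyal i a (moyal j b c))]
    have h₁ : ∀ (k m : ℕ) (u v w : SmoothSymbol), ((m : ℂ) + 1) • moyal k (moyal (m + 1) u v) w =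
        moyal k (((m : ℂ) + 1) • moyal (m + 1) u v) w := by simp
    have h₂ : ∀ (k m : ℕ) (u v w : SmoothSymbol), ((m : ℂ) + 1) • moyal k u (moyal (m + 1) v w) =
        moyal k u (((m : ℂ) + 1) • moyal (m + 1) v w) := by simp
    simp only [h₁, h₂, succ_smul_moyal_succ, map_smul, LinearMap.smul_apply, ← Finset.smul_sum,
      ← smul_add]
    congr 1
    simp only [map_sum, LinearMap.sum_apply, map_sub, LinearMap.sub_apply, derivP_moyal,
      derivQ_moyal, map_add, LinearMap.add_apply]
    simp only [Finset.sum_comm (s := Finset.HasAntidiagonal.antidiagonal n) (t := Finset.univ)]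
    simp only [← Finset.sum_add_distrib]
    refine Finset.sum_congr rfl fun i _ => ?_
    simp only [Finset.sum_add_distrib, Finset.sum_sub_distrib, ih]
    abel

/-- The bidifferential operator is antisymmetric, so each of its n applications contributes a sign.
-/
lemma moyal_swap (n : ℕ) (a b : SmoothSymbol) : moyal n b a = (-1 : ℂ) ^ n • moyal n a b := by
  induction n generalizing a b with
  | zero => simp [moyal_zero, mul_comm]
  | succ n ih =>
    rw [moyal_succ, moyal_succ, smul_comm]
    congr 1
    rw [Finset.smul_sum]
    refine Finset.sum_congr rfl fun i _ => ?_
    rw [ih (derivQ i a), ih (derivP i a), pow_succ, smul_sub]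
    simp only [mul_neg, mul_one, neg_smul]
    abel

lemma moyal_succ_one_left (n : ℕ) (b : SmoothSymbol) : moyal (n + 1) 1 b = 0 := by
  rw [moyal_succ]
  simp [derivP, derivQ, directional_one]

/-! ### Agreement with the multi-index formula for the Moyal product -/

/-- `∂_p^α` on smooth symbols. -/
def multiP (α : ℕ × ℕ) : Module.End ℂ SmoothSymbol := derivP 0 ^ α.1 * derivP 1 ^ α.2

/-- `∂_q^α` on smooth symbols. -/
def multiQ (α : ℕ × ℕ) : Module.End ℂ SmoothSymbol := derivQ 0 ^ α.1 * derivQ 1 ^ α.2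

lemma coe_iterate_of_coe {D : SmoothSymbol → SmoothSymbol} {E : ScalarSymbol → ScalarSymbol}
    (h : ∀ a : SmoothSymbol, (D a : ScalarSymbol) = E a) (n : ℕ) (a : SmoothSymbol) :
    (D^[n] a : ScalarSymbol) = E^[n] a :=
  Function.Semiconj.iterate_right (f := fun a : SmoothSymbol => (a : ScalarSymbol)) h n a

lemma coe_multiP (α : ℕ × ℕ) (a : SmoothSymbol) : (multiP α a : ScalarSymbol) = dpMulti α a := by
  simp only [multiP, dpMulti, Module.End.mul_apply, Module.End.pow_apply]
  rw [coe_iterate_of_coe (coe_derivP 0), coe_iterate_of_coe (coe_derivP 1)]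

lemma coe_multiQ (α : ℕ × ℕ) (a : SmoothSymbol) : (multiQ α a : ScalarSymbol) = dqMulti α a := by
  simp only [multiQ, dqMulti, Module.End.mul_apply, Module.End.pow_apply]
  rw [coe_iterate_of_coe (coe_derivQ 0), coe_iterate_of_coe (coe_derivQ 1)]

lemma commute_derivP (i j : Fin 2) : Commute (derivP i : Module.End ℂ SmoothSymbol) (derivP j) :=
  LinearMap.ext (derivP_derivP i j)

lemma commute_derivQ (i j : Fin 2) : Commute (derivQ i : Module.End ℂ SmoothSymbol) (derivQ j) :=
  LinearMap.ext (derivQ_derivQ i j)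

lemma commute_derivP_derivQ (i j : Fin 2) :
    Commute (derivP i : Module.End ℂ SmoothSymbol) (derivQ j) :=
  LinearMap.ext (derivP_derivQ i j)

lemma multiP_succ_left (m n : ℕ) : multiP (m + 1, n) = multiP (m, n) * derivP 0 := by
  simp only [multiP, pow_succ, mul_assoc, ((commute_derivP 0 1).pow_right n).eq]

lemma multiP_succ_right (m n : ℕ) : multiP (m, n + 1) = multiP (m, n) * derivP 1 := by
  simp only [multiP, pow_succ, mul_assoc]

lemma multiQ_succ_left (m n : ℕ) : multiQ (m + 1, n) = multiQ (m, n) * derivQ 0 := by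
  simp only [multiQ, pow_succ, mul_assoc, ((commute_derivQ 0 1).pow_right n).eq]

lemma multiQ_succ_right (m n : ℕ) : multiQ (m, n + 1) = multiQ (m, n) * derivQ 1 := by
  simp only [multiQ, pow_succ, mul_assoc]

lemma commute_multiP_derivP (α : ℕ × ℕ) (i : Fin 2) : Commute (multiP α) (derivP i) :=
  Commute.mul_left ((commute_derivP _ _).pow_left _) ((commute_derivP _ _).pow_left _)

lemma commute_multiQ_derivQ (α : ℕ × ℕ) (i : Fin 2) : Commute (multiQ α) (derivQ i) :=
  Commute.mul_left ((commute_derivQ _ _).pow_left _) ((commute_derivQ _ _).pow_left _)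

lemma commute_multiP_derivQ (α : ℕ × ℕ) (i : Fin 2) : Commute (multiP α) (derivQ i) :=
  Commute.mul_left ((commute_derivP_derivQ _ _).pow_left _) ((commute_derivP_derivQ _ _).pow_left _)

lemma commute_multiQ_derivP (α : ℕ × ℕ) (i : Fin 2) : Commute (multiQ α) (derivP i) :=
  Commute.mul_left ((commute_derivP_derivQ _ _).symm.pow_left _)
    ((commute_derivP_derivQ _ _).symm.pow_left _)

/-- The sum `(2i)^l (a # b)_l` written with multi-indices. -/
def moyalSum (l : ℕ) (a b : SmoothSymbol) : SmoothSymbol :=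
  ∑ ν ∈ Finset.HasAntidiagonal.antidiagonal l,
    ∑ α ∈ Finset.HasAntidiagonal.antidiagonal ν.1, ∑ β ∈ Finset.HasAntidiagonal.antidiagonal ν.2,
      ((-1) ^ ν.2 / (α.1 ! * α.2 ! * β.1 ! * β.2 ! : ℂ)) •
        (multiP α (multiQ β a) * multiQ α (multiP β b))

lemma coe_moyalSum (l : ℕ) (a b : SmoothSymbol) :
    (1 / (2 * Complex.I) ^ l : ℂ) • (moyalSum l a b : ScalarSymbol) = moyalTerm l a b := by
  simp only [moyalSum, moyalTerm, map_sum, map_smul, map_mul, coe_multiP, coe_multiQ]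

/-- The multi-index sum obeys the recursion of `moyal`, apart from the powers of 2i. Raising an
entry of α produces a term ∂_{p_i} ⊗ ∂_{q_i}, and raising an entry of β a term −∂_{q_i} ⊗ ∂_{p_i}.
-/
lemma succ_smul_moyalSum_succ (l : ℕ) (a b : SmoothSymbol) :
    ((l : ℂ) + 1) • moyalSum (l + 1) a b =
      ∑ i, (moyalSum l (derivP i a) (derivQ i b) - moyalSum l (derivQ i a) (derivP i b)) := by
  have hf : ∀ n : ℕ, ((n ! : ℕ) : ℂ) ≠ 0 := fun n => Nat.cast_ne_zero.mpr n.factorial_ne_zero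
  have hs : ∀ n : ℕ, (n : ℂ) + 1 ≠ 0 := Nat.cast_add_one_ne_zero
  let G : ℕ → ℕ → ℕ → ℕ → ℕ → SmoothSymbol := fun e α₁ α₂ β₁ β₂ =>
    ((-1) ^ e / (α₁ ! * α₂ ! * β₁ ! * β₂ ! : ℂ)) •
      (multiP (α₁, α₂) (multiQ (β₁, β₂) a) * multiQ (α₁, α₂) (multiP (β₁, β₂) b))
  let u : ℕ → ℕ → SmoothSymbol := fun m m' => ∑ α ∈ Finset.HasAntidiagonal.antidiagonal m,
    ∑ β ∈ Finset.HasAntidiagonal.antidiagonal m', G m' α.1 α.2 β.1 β.2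
  have hu₁ : ∀ m m' : ℕ, ((m : ℂ) + 1) • u (m + 1) m' = ∑ α ∈ Finset.HasAntidiagonal.antidiagonal m,
      ∑ β ∈ Finset.HasAntidiagonal.antidiagonal m', (((α.1 : ℂ) + 1) • G m' (α.1 + 1) α.2 β.1 β.2 +
        ((α.2 : ℂ) + 1) • G m' α.1 (α.2 + 1) β.1 β.2) := fun m m' =>
    (sum_antidiagonal_succ_smul (fun α₁ α₂ => ∑ β ∈ Finset.HasAntidiagonal.antidiagonal m',
      G m' α₁ α₂ β.1 β.2) m).trans (by simp only [Finset.smul_sum, Finset.sum_add_distrib])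
  have hu₂ : ∀ m m' : ℕ, ((m' : ℂ) + 1) • u m (m' + 1) = ∑ α ∈ Finset.HasAntidiagonal.antidiagonal m,
      ∑ β ∈ Finset.HasAntidiagonal.antidiagonal m',
        (((β.1 : ℂ) + 1) • G (m' + 1) α.1 α.2 (β.1 + 1) β.2 +
          ((β.2 : ℂ) + 1) • G (m' + 1) α.1 α.2 β.1 (β.2 + 1)) := fun m m' => by
    rw [Finset.smul_sum]
    refine Finset.sum_congr rfl fun α _ => ?_
    rw [sum_antidiagonal_succ_smul (fun β₁ β₂ => G (m' + 1) α.1 α.2 β₁ β₂), Finset.sum_add_distrib]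
  rw [show moyalSum (l + 1) a b =
    ∑ ν ∈ Finset.HasAntidiagonal.antidiagonal (l + 1), u ν.1 ν.2 from rfl,
    sum_antidiagonal_succ_smul u]
  simp only [hu₁, hu₂]
  simp only [Fin.sum_univ_two, moyalSum, ← Finset.sum_add_distrib,
    ← Finset.sum_sub_distrib]
  refine Finset.sum_congr rfl fun ν _ => Finset.sum_congr rfl fun α _ =>
    Finset.sum_congr rfl fun β _ => ?_
  simp only [G, multiP_succ_left, multiP_succ_right, multiQ_succ_left, multiQ_succ_right]
  have c₁ := fun (α : ℕ × ℕ) i x => congrArg (fun f => f x) (commute_multiQ_derivP α i).eq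
  have c₂ := fun (α : ℕ × ℕ) i x => congrArg (fun f => f x) (commute_multiP_derivQ α i).eq
  have c₃ := fun (α : ℕ × ℕ) i x => congrArg (fun f => f x) (commute_multiP_derivP α i).eq
  have c₄ := fun (α : ℕ × ℕ) i x => congrArg (fun f => f x) (commute_multiQ_derivQ α i).eq
  simp only [Module.End.mul_apply] at c₁ c₂ c₃ c₄ ⊢
  simp only [c₁, c₂, c₃, c₄, smul_smul, Nat.factorial_succ, Nat.cast_mul, Nat.cast_succ, pow_succ]
  -- The factor supplied by the antidiagonal identity cancels the new factor of the raised
  -- factorial, so all four terms carry the same coefficient up to the sign that comes with raising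
  -- β.
  set k : ℂ := (-1) ^ ν.2 / (α.1 ! * α.2 ! * β.1 ! * β.2 ! : ℂ) with hk
  have e₁ : ((α.1 : ℂ) + 1) * ((-1) ^ ν.2 / (((α.1 : ℂ) + 1) * α.1 ! * α.2 ! * β.1 ! * β.2 !)) =
      k := by
    have := hs α.1
    rw [hk]; field_simp
  have e₂ : ((α.2 : ℂ) + 1) * ((-1) ^ ν.2 / (α.1 ! * (((α.2 : ℂ) + 1) * α.2 !) * β.1 ! * β.2 !)) =
      k := by
    have := hs α.2
    rw [hk]; field_simp
  have e₃ : ((β.1 : ℂ) + 1) *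
      ((-1) ^ ν.2 * -1 / (α.1 ! * α.2 ! * (((β.1 : ℂ) + 1) * β.1 !) * β.2 !)) = -k := by
    have := hs β.1
    rw [hk]; field_simp
  have e₄ : ((β.2 : ℂ) + 1) *
      ((-1) ^ ν.2 * -1 / (α.1 ! * α.2 ! * β.1 ! * (((β.2 : ℂ) + 1) * β.2 !))) = -k := by
    have := hs β.2
    rw [hk]; field_simp
  rw [e₁, e₂, e₃, e₄]
  module

lemma smul_moyal (l : ℕ) (a b : SmoothSymbol) :
    (2 * Complex.I) ^ l • moyal l a b = moyalSum l a b := by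
  induction l generalizing a b with
  | zero => simp [moyalSum, moyal_zero, multiP, multiQ]
  | succ l ih =>
    have hl : (l : ℂ) + 1 ≠ 0 := Nat.cast_add_one_ne_zero l
    refine smul_right_injective _ hl ?_
    change ((l : ℂ) + 1) • _ = ((l : ℂ) + 1) • _
    rw [smul_comm, succ_smul_moyal_succ, succ_smul_moyalSum_succ, smul_smul, pow_succ, mul_assoc,
      mul_one_div_cancel (by simp), mul_one, Finset.smul_sum]
    simp only [smul_sub, ih]

lemma moyal_eq (l : ℕ) (a b : SmoothSymbol) :
    moyal l a b = (1 / (2 * Complex.I) ^ l : ℂ) • moyalSum l a b := by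
  rw [← smul_moyal, smul_smul, one_div_mul_cancel (by simp), one_smul]

lemma coe_moyal (l : ℕ) (a b : SmoothSymbol) :
    (moyal l a b : ScalarSymbol) = moyalTerm l a b := by
  rw [moyal_eq, map_smul, coe_moyalSum]

/-! ### Conjugation and the star ring of formal symbols -/

/-- Pointwise complex conjugation. -/
instance : StarRing SmoothSymbol where
  star a := .mk (fun z => star ((a : ScalarSymbol) z))
    ((starL' ℝ : ℂ ≃L[ℝ] ℂ).contDiff.comp a.contDiff)
  star_involutive a := by ext z; simp
  star_mul a b := by ext z; simp [mul_comm]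
  star_add a b := by ext z; simp

lemma coe_star (a : SmoothSymbol) : ((star a : SmoothSymbol) : ScalarSymbol) = star (a : ScalarSymbol) :=
  rfl

lemma star_smul_smooth (c : ℂ) (a : SmoothSymbol) : star (c • a) = star c • star a := by
  ext z
  simp [coe_star]

lemma star_directional (v : PhaseSpace) (a : SmoothSymbol) :
    star (directional v a) = directional v (star a) := by
  ext z
  change star (fderiv ℝ (a : ScalarSymbol) z v) =
    fderiv ℝ ((starL' ℝ : ℂ ≃L[ℝ] ℂ) ∘ (a : ScalarSymbol)) z v
  rw [ContinuousLinearEquiv.comp_fderiv]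
  rfl

/-- Conjugating (1/2i)^n gives (−1)^n, and exchanging the factors gives the same sign again;
together they cancel, so conjugation reverses Moyal products. -/
lemma star_moyal (n : ℕ) (a b : SmoothSymbol) :
    star (moyal n a b) = moyal n (star b) (star a) := by
  have h : star (moyal n a b) = (-1 : ℂ) ^ n • moyal n (star a) (star b) := by
    induction n generalizing a b with
    | zero => simp [moyal_zero]
    | succ n ih =>
      rw [moyal_succ, moyal_succ, star_smul_smooth, star_sum, Finset.smul_sum, Finset.smul_sum,
        Finset.smul_sum]
      refine Finset.sum_congr rfl fun i _ => ?_
      rw [star_sub, ih, ih]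
      simp only [derivP, derivQ, star_directional, pow_succ, ← smul_sub, smul_smul]
      congr 1
      simp
      ring
  rw [h, ← moyal_swap]

/-- Formal power series in `ε` with smooth symbols as coefficients. -/
def FormalSymbol : Type := ℕ → SmoothSymbol

/-- Only the additive structure comes from the function type; its pointwise product must not be
inherited, since multiplication here is the Moyal product. -/
instance : AddCommGroup FormalSymbol := inferInstanceAs (AddCommGroup (ℕ → SmoothSymbol))

namespace FormalSymbol

/-- The coefficient of `ε^n`. -/
def coeff (n : ℕ) : FormalSymbol →+ SmoothSymbol := Pi.evalAddMonoidHom (fun _ => SmoothSymbol) n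

/-- The series with given coefficients. -/
def mk (f : ℕ → SmoothSymbol) : FormalSymbol := f

@[simp]
lemma coeff_mk (f : ℕ → SmoothSymbol) (n : ℕ) : coeff n (mk f) = f n := rfl

@[ext]
lemma ext {f g : FormalSymbol} (h : ∀ n, coeff n f = coeff n g) : f = g := funext h

instance : Mul FormalSymbol where
  mul f g := mk fun n => ∑ u ∈ Finset.HasAntidiagonal.antidiagonal n,
    ∑ v ∈ Finset.HasAntidiagonal.antidiagonal u.2, moyal u.1 (coeff v.1 f) (coeff v.2 g)

instance : One FormalSymbol where
  one := mk fun n => if n = 0 then 1 else 0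

lemma coeff_mul (n : ℕ) (f g : FormalSymbol) :
    coeff n (f * g) = ∑ u ∈ Finset.HasAntidiagonal.antidiagonal n,
      ∑ v ∈ Finset.HasAntidiagonal.antidiagonal u.2, moyal u.1 (coeff v.1 f) (coeff v.2 g) := rfl

lemma coeff_one (n : ℕ) : coeff n (1 : FormalSymbol) = if n = 0 then 1 else 0 := rfl

/-- Both sides are reindexed so that the orders of the three coefficients are fixed outside and the
total Moyal order is split innermost. `moyal_assoc` then identifies the inner sums. -/
protected lemma mul_assoc (f g h : FormalSymbol) : f * g * h = f * (g * h) := by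
  ext1 n
  let A (m : ℕ) := Finset.HasAntidiagonal.antidiagonal m
  have hl : coeff n (f * g * h) = ∑ w ∈ A n, ∑ r ∈ A w.2, ∑ s ∈ A r.2, ∑ k ∈ A w.1,
      moyal k.1 (moyal k.2 (coeff r.1 f) (coeff s.1 g)) (coeff s.2 h) := by
    simp only [coeff_mul, map_sum, LinearMap.sum_apply]
    simp only [A, Finset.sum_sigma']
    refine Finset.sum_nbij'
      (fun x => ⟨(x.1.1 + x.2.2.1.1, x.2.2.1.2 + x.2.1.2), (x.2.2.2.1, x.2.2.2.2 + x.2.1.2),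
        (x.2.2.2.2, x.2.1.2), (x.1.1, x.2.2.1.1)⟩)
      (fun y => ⟨(y.2.2.2.1, y.2.2.2.2 + y.1.2), (y.2.2.2.2 + y.2.1.1 + y.2.2.1.1, y.2.2.1.2),
        (y.2.2.2.2, y.2.1.1 + y.2.2.1.1), (y.2.1.1, y.2.2.1.1)⟩) ?_ ?_ ?_ ?_ ?_
    · rintro ⟨⟨a, b⟩, ⟨c, d⟩, ⟨e, f⟩, ⟨g, h⟩⟩
      simp only [Finset.mem_sigma, Finset.HasAntidiagonal.mem_antidiagonal]
      rintro ⟨rfl, rfl, rfl, rfl⟩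
      simp only [and_true]
      omega
    · rintro ⟨⟨a, b⟩, ⟨c, d⟩, ⟨e, f⟩, ⟨g, h⟩⟩
      simp only [Finset.mem_sigma, Finset.HasAntidiagonal.mem_antidiagonal]
      rintro ⟨rfl, rfl, rfl, rfl⟩
      simp only [and_true]
      omega
    · rintro ⟨⟨a, b⟩, ⟨c, d⟩, ⟨e, f⟩, ⟨g, h⟩⟩
      simp only [Finset.mem_sigma, Finset.HasAntidiagonal.mem_antidiagonal]
      rintro ⟨rfl, rfl, rfl, rfl⟩
      simp [add_assoc]
    · rintro ⟨⟨a, b⟩, ⟨c, d⟩, ⟨e, f⟩, ⟨g, h⟩⟩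
      simp only [Finset.mem_sigma, Finset.HasAntidiagonal.mem_antidiagonal]
      rintro ⟨rfl, rfl, rfl, rfl⟩
      simp [add_assoc]
    · rintro ⟨⟨a, b⟩, ⟨c, d⟩, ⟨e, f⟩, ⟨g, h⟩⟩ _
      rfl
  have hr : coeff n (f * (g * h)) = ∑ w ∈ A n, ∑ r ∈ A w.2, ∑ s ∈ A r.2, ∑ k ∈ A w.1,
      moyal k.1 (coeff r.1 f) (moyal k.2 (coeff s.1 g) (coeff s.2 h)) := by
    simp only [coeff_mul, map_sum]
    simp only [A, Finset.sum_sigma']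
    refine Finset.sum_nbij'
      (fun x => ⟨(x.1.1 + x.2.2.1.1, x.2.1.1 + x.2.2.1.2), (x.2.1.1, x.2.2.1.2),
        (x.2.2.2.1, x.2.2.2.2), (x.1.1, x.2.2.1.1)⟩)
      (fun y => ⟨(y.2.2.2.1, y.2.2.2.2 + y.1.2), (y.2.1.1, y.2.2.2.2 + y.2.1.2),
        (y.2.2.2.2, y.2.1.2), (y.2.2.1.1, y.2.2.1.2)⟩) ?_ ?_ ?_ ?_ ?_
    · rintro ⟨⟨a, b⟩, ⟨c, d⟩, ⟨e, f⟩, ⟨g, h⟩⟩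
      simp only [Finset.mem_sigma, Finset.HasAntidiagonal.mem_antidiagonal]
      rintro ⟨rfl, rfl, rfl, rfl⟩
      simp only [and_true]
      omega
    · rintro ⟨⟨a, b⟩, ⟨c, d⟩, ⟨e, f⟩, ⟨g, h⟩⟩
      simp only [Finset.mem_sigma, Finset.HasAntidiagonal.mem_antidiagonal]
      rintro ⟨rfl, rfl, rfl, rfl⟩
      simp only [and_true]
      omega
    · rintro ⟨⟨a, b⟩, ⟨c, d⟩, ⟨e, f⟩, ⟨g, h⟩⟩
      simp only [Finset.mem_sigma, Finset.HasAntidiagonal.mem_antidiagonal]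
      rintro ⟨rfl, rfl, rfl, rfl⟩
      simp [add_left_comm]
    · rintro ⟨⟨a, b⟩, ⟨c, d⟩, ⟨e, f⟩, ⟨g, h⟩⟩
      simp only [Finset.mem_sigma, Finset.HasAntidiagonal.mem_antidiagonal]
      rintro ⟨rfl, rfl, rfl, rfl⟩
      simp
    · rintro ⟨⟨a, b⟩, ⟨c, d⟩, ⟨e, f⟩, ⟨g, h⟩⟩ _
      rfl
  rw [hl, hr]
  simp only [A, moyal_assoc]

protected lemma one_mul (f : FormalSymbol) : 1 * f = f := by
  ext1 n
  rw [coeff_mul, Finset.sum_eq_single (0, n), Finset.sum_eq_single (0, n)]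
  · simp [coeff_one, moyal_zero]
  · rintro ⟨i, j⟩ hij hne
    simp only [Finset.HasAntidiagonal.mem_antidiagonal, ne_eq, Prod.mk.injEq] at hij hne
    rw [coeff_one, if_neg (by dsimp only; omega)]
    simp
  · simp
  · rintro ⟨i, j⟩ hij hne
    simp only [Finset.HasAntidiagonal.mem_antidiagonal, ne_eq, Prod.mk.injEq] at hij hne
    refine Finset.sum_eq_zero fun v _ => ?_
    obtain ⟨i, rfl⟩ : ∃ k, i = k + 1 := ⟨i - 1, by omega⟩
    rw [coeff_one]
    split_ifs
    · exact moyal_succ_one_left _ _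
    · simp
  · simp

instance : StarAddMonoid FormalSymbol where
  star f := mk fun n => star (coeff n f)
  star_involutive f := by ext1 n; simp
  star_add f g := by ext1 n; simp

@[simp]
lemma coeff_star (n : ℕ) (f : FormalSymbol) : coeff n (star f) = star (coeff n f) := rfl

protected lemma star_mul (f g : FormalSymbol) : star (f * g) = star g * star f := by
  ext1 n
  simp only [coeff_star, coeff_mul, star_sum, star_moyal]
  exact Finset.sum_congr rfl fun u _ => Finset.sum_nbij' Prod.swap Prod.swap
    (by simp [add_comm]) (by simp [add_comm]) (by simp) (by simp) (by simp)

protected lemma star_one : star (1 : FormalSymbol) = 1 := by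
  ext1 n
  rw [coeff_star, coeff_one]
  split_ifs <;> simp

instance : Ring FormalSymbol where
  mul_assoc := FormalSymbol.mul_assoc
  left_distrib f g h := by
    ext1 n
    simp only [map_add, coeff_mul, Finset.sum_add_distrib]
  right_distrib f g h := by
    ext1 n
    simp only [map_add, coeff_mul, LinearMap.add_apply, Finset.sum_add_distrib]
  zero_mul f := by ext1 n; simp [coeff_mul]
  mul_zero f := by ext1 n; simp [coeff_mul]
  one_mul := FormalSymbol.one_mul
  mul_one f := by
    have h := congrArg star (FormalSymbol.one_mul (star f))
    rwa [FormalSymbol.star_mul, star_star, FormalSymbol.star_one] at h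
  neg_add_cancel := neg_add_cancel
  zsmul := zsmulRec

instance : StarRing FormalSymbol where
  star_mul := FormalSymbol.star_mul
  star_add := star_add

/-- The substitution `ε ↦ -ε`. -/
def flip : FormalSymbol →+ FormalSymbol where
  toFun f := mk fun n => (-1 : ℂ) ^ n • coeff n f
  map_zero' := by ext1 n; simp
  map_add' f g := by ext1 n; simp

@[simp]
lemma coeff_flip (n : ℕ) (f : FormalSymbol) : coeff n (flip f) = (-1 : ℂ) ^ n • coeff n f := rfl

/-- The sign (−1)^n splits over the orders of the two coefficients and the Moyal order; the last
part is exactly the cost of exchanging the factors. -/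
lemma flip_mul (f g : FormalSymbol) : flip (f * g) = flip g * flip f := by
  ext1 n
  simp only [coeff_flip, coeff_mul, Finset.smul_sum]
  refine Finset.sum_congr rfl fun u hu => Finset.sum_nbij' Prod.swap Prod.swap
    (by simp [add_comm]) (by simp [add_comm]) (by simp) (by simp) fun v hv => ?_
  simp only [Finset.HasAntidiagonal.mem_antidiagonal] at hu hv
  rw [← hu, ← hv, moyal_swap _ ((-1 : ℂ) ^ _ • _)]
  simp only [Prod.fst_swap, Prod.snd_swap, map_smul, LinearMap.smul_apply, smul_smul]
  congr 1
  rw [pow_add, pow_add]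
  ring

/-- Moyal corrections raise the order, so the first possibly nonzero coefficient of a product only
sees ordinary multiplication. All later arguments about leading terms rest on this. -/
lemma coeff_mul_of_left {n : ℕ} {f : FormalSymbol} (hf : ∀ k < n, coeff k f = 0)
    (g : FormalSymbol) : coeff n (f * g) = coeff n f * coeff 0 g := by
  rw [coeff_mul, Finset.sum_eq_single (0, n), Finset.sum_eq_single (n, 0)]
  · rfl
  · rintro ⟨i, j⟩ hij hne
    simp only [Finset.HasAntidiagonal.mem_antidiagonal, ne_eq, Prod.mk.injEq] at hij hne
    rw [hf i (by omega)]
    simp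
  · simp
  · rintro ⟨i, j⟩ hij hne
    simp only [Finset.HasAntidiagonal.mem_antidiagonal, ne_eq, Prod.mk.injEq] at hij hne
    refine Finset.sum_eq_zero fun v hv => ?_
    simp only [Finset.HasAntidiagonal.mem_antidiagonal] at hv
    rw [hf v.1 (by omega)]
    simp
  · simp

lemma coeff_mul_of_right {n : ℕ} {g : FormalSymbol} (hg : ∀ k < n, coeff k g = 0)
    (f : FormalSymbol) : coeff n (f * g) = coeff 0 f * coeff n g := by
  have h := coeff_mul_of_left (f := star g) (n := n) (fun k hk => by simp [hg k hk]) (star f)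
  rw [← star_mul, coeff_star, coeff_star, coeff_star, ← star_mul] at h
  exact star_injective h

end FormalSymbol

/-! ### Matrices of formal symbols and orders of vanishing -/

/-- `2 × 2` matrices of formal symbols. -/
abbrev FormalMatrix : Type := Matrix (Fin 2) (Fin 2) FormalSymbol

/-- `2 × 2` matrices of smooth symbols. -/
abbrev SmoothMatrix : Type := Matrix (Fin 2) (Fin 2) SmoothSymbol

namespace FormalMatrix

open FormalSymbol (coeff)

/-- The coefficient of `ε^n`. -/
def coeffM (n : ℕ) : FormalMatrix →+ SmoothMatrix := (coeff n).mapMatrix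

lemma coeffM_apply (n : ℕ) (A : FormalMatrix) (i j : Fin 2) :
    coeffM n A i j = coeff n (A i j) := rfl

lemma ext_coeffM {A B : FormalMatrix} (h : ∀ n, coeffM n A = coeffM n B) : A = B := by
  exact Matrix.ext fun i j => FormalSymbol.ext fun n => congrFun (congrFun (h n) i) j

/-- The series with given coefficients. -/
def ofCoeff (A : ℕ → SmoothMatrix) : FormalMatrix := .of fun i j => .mk fun n => A n i j

@[simp]
lemma coeffM_ofCoeff (A : ℕ → SmoothMatrix) (n : ℕ) : coeffM n (ofCoeff A) = A n := rfl

@[simp]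
lemma coeffM_zero_one : coeffM 0 (1 : FormalMatrix) = 1 := by
  refine Matrix.ext fun i j => ?_
  by_cases h : i = j <;> simp [coeffM_apply, Matrix.one_apply, h, FormalSymbol.coeff_one]

lemma coeffM_one {n : ℕ} (hn : n ≠ 0) : coeffM n (1 : FormalMatrix) = 0 := by
  refine Matrix.ext fun i j => ?_
  by_cases h : i = j <;> simp [coeffM_apply, h, FormalSymbol.coeff_one, hn]

@[simp]
lemma coeffM_star (n : ℕ) (A : FormalMatrix) : coeffM n (star A) = star (coeffM n A) := rfl

lemma coeffM_mul_of_left {n : ℕ} {A : FormalMatrix} (hA : ∀ k < n, coeffM k A = 0)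
    (B : FormalMatrix) : coeffM n (A * B) = coeffM n A * coeffM 0 B := by
  refine Matrix.ext fun i j => ?_
  simp only [coeffM_apply, Matrix.mul_apply, map_sum]
  exact Finset.sum_congr rfl fun s _ => FormalSymbol.coeff_mul_of_left
    (fun k hk => congrFun (congrFun (hA k hk) i) s) _

lemma coeffM_mul_of_right {n : ℕ} {B : FormalMatrix} (hB : ∀ k < n, coeffM k B = 0)
    (A : FormalMatrix) : coeffM n (A * B) = coeffM 0 A * coeffM n B := by
  refine Matrix.ext fun i j => ?_
  simp only [coeffM_apply, Matrix.mul_apply, map_sum]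
  exact Finset.sum_congr rfl fun s _ => FormalSymbol.coeff_mul_of_right
    (fun k hk => congrFun (congrFun (hB k hk) s) j) _

lemma coeffM_zero_mul (A B : FormalMatrix) : coeffM 0 (A * B) = coeffM 0 A * coeffM 0 B :=
  coeffM_mul_of_left (by simp) B

/-- `A = O(ε^m)`. -/
def VanishesBelow (m : ℕ) (A : FormalMatrix) : Prop := ∀ k < m, coeffM k A = 0

namespace VanishesBelow

variable {m : ℕ} {A B : FormalMatrix}

lemma add (hA : VanishesBelow m A) (hB : VanishesBelow m B) : VanishesBelow m (A + B) :=
  fun k hk => by rw [map_add, hA k hk, hB k hk, add_zero]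

lemma sub (hA : VanishesBelow m A) (hB : VanishesBelow m B) : VanishesBelow m (A - B) :=
  fun k hk => by rw [map_sub, hA k hk, hB k hk, sub_zero]

lemma mul_right (hA : VanishesBelow m A) (B : FormalMatrix) : VanishesBelow m (A * B) :=
  fun k hk => by rw [coeffM_mul_of_left fun j hj => hA j (hj.trans hk), hA k hk, zero_mul]

lemma mul_left (hA : VanishesBelow m A) (B : FormalMatrix) : VanishesBelow m (B * A) :=
  fun k hk => by rw [coeffM_mul_of_right fun j hj => hA j (hj.trans hk), hA k hk, mul_zero]

lemma mono {m' : ℕ} (hA : VanishesBelow m A) (h : m' ≤ m) : VanishesBelow m' A :=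
  fun k hk => hA k (hk.trans_le h)

lemma coeffM_mul (hA : VanishesBelow m A) (B : FormalMatrix) :
    coeffM m (A * B) = coeffM m A * coeffM 0 B := coeffM_mul_of_left hA B

lemma coeffM_mul_left (hA : VanishesBelow m A) (B : FormalMatrix) :
    coeffM m (B * A) = coeffM 0 B * coeffM m A := coeffM_mul_of_right hA B

end VanishesBelow

/-! ### Diagonalization order by order -/

/-- The off-diagonal entries are `O(ε^m)`. -/
def DiagonalBelow (m : ℕ) (A : FormalMatrix) : Prop :=
  ∀ k < m, coeffM k A 0 1 = 0 ∧ coeffM k A 1 0 = 0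

/-- For k > 0 the quadratic term N X N* has order beyond k, so up to order k conjugation by 1 + N is
linear in N. -/
lemma coeffM_conj_one_add {k : ℕ} (hk : k ≠ 0) {N : FormalMatrix} (hN : VanishesBelow k N)
    (X : FormalMatrix) {j : ℕ} (hj : j ≤ k) :
    coeffM j ((1 + N) * X * star (1 + N)) =
      coeffM j X + coeffM j N * coeffM 0 X + coeffM 0 X * star (coeffM j N) := by
  have h : (1 + N) * X * star (1 + N) = X + N * X + X * star N + N * (X * star N) := by
    rw [star_add, star_one]
    noncomm_ring
  have hN' : VanishesBelow k (star N) := fun i hi => by rw [coeffM_star, hN i hi, star_zero]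
  have h₀ : coeffM 0 (star N) = 0 := hN' 0 (Nat.pos_of_ne_zero hk)
  rw [h, map_add, map_add, map_add, (hN.mono hj).coeffM_mul, (hN'.mono hj).coeffM_mul_left,
    (hN.mono hj).coeffM_mul, coeffM_zero_mul, h₀, mul_zero, mul_zero, add_zero, coeffM_star]

/-- In (U*U − 1)U* = U*(UU* − 1) the right side is small, and the leading term R* of U* can be
cancelled. Unitarity therefore needs to be constructed on one side only. -/
lemma vanishesBelow_star_mul_self {m : ℕ} {U : FormalMatrix} {R : SmoothMatrix}
    (hR : star R * R = 1) (hU : coeffM 0 U = R) (h : VanishesBelow m (U * star U - 1)) :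
    VanishesBelow m (star U * U - 1) := by
  intro k
  induction k using Nat.strong_induction_on with
  | _ k ih =>
    intro hk
    have h₁ : (star U * U - 1) * star U = star U * (U * star U - 1) := by noncomm_ring
    have h₂ := congrArg (coeffM k) h₁
    rw [coeffM_mul_of_left fun j hj => ih j hj (hj.trans hk), h.mul_left _ k hk, coeffM_star,
      hU] at h₂
    have h₃ := congrArg (· * R) h₂
    simpa [mul_assoc, hR] using h₃

/-- A self-adjoint series whose leading term is diagonalized by `R` with two distinct eigenvalues
can be diagonalized to every finite order by a series that is unitary to that order. -/
theorem exists_diagonalizing_unitary {T : FormalMatrix} (hT : star T = T) {R D : SmoothMatrix}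
    (hR : R * star R = 1) (hD : R * coeffM 0 T * star R = D) (h₀₁ : D 0 1 = 0) (h₁₀ : D 1 0 = 0)
    {g : SmoothSymbol} (hg : star g = g) (hgap : g * (D 0 0 - D 1 1) = 1) (m : ℕ) :
    ∃ U : FormalMatrix, coeffM 0 U = R ∧ VanishesBelow (m + 1) (U * star U - 1) ∧
      DiagonalBelow (m + 1) (U * T * star U) := by
  induction m with
  | zero =>
    refine ⟨ofCoeff fun _ => R, rfl, fun k hk => ?_, fun k hk => ?_⟩
    · obtain rfl : k = 0 := by omega
      rw [map_sub, coeffM_zero_mul, coeffM_star, coeffM_ofCoeff, hR, coeffM_zero_one, sub_self]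
    · obtain rfl : k = 0 := by omega
      rw [coeffM_zero_mul, coeffM_zero_mul, coeffM_star, coeffM_ofCoeff, hD]
      exact ⟨h₀₁, h₁₀⟩
  | succ m ih =>
    obtain ⟨U, hU, hUU, hUT⟩ := ih
    set k := m + 1 with hk
    let S := coeffM k (U * star U)
    let P := coeffM k (U * T * star U)
    have hS : star S = S := by
      simp only [S, ← coeffM_star, star_mul, star_star]
    have hP : star P = P := by
      simp only [P, ← coeffM_star, star_mul, star_star, hT, mul_assoc]
    have hDs : star D = D := by
      rw [← hD, ← hU]
      simp only [← coeffM_star, ← coeffM_zero_mul, star_mul, star_star, hT, mul_assoc]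
    -- Here S is the defect of unitarity at order k. The correction C will have self-adjoint part
    -- −S/2, which cancels S and changes the order-k coefficient of UTU* from P to Q.
    let Q := P - (1 / 2 : ℂ) • (S * D + D * S)
    have hQ : star Q = Q := by
      have : star ((1 / 2 : ℂ) • (S * D + D * S)) = (1 / 2 : ℂ) • (S * D + D * S) := by
        refine Matrix.ext fun i j => ?_
        rw [Matrix.star_apply, Matrix.smul_apply, star_smul_smooth, Matrix.smul_apply,
          ← Matrix.star_apply, star_add, star_mul, star_mul, hS, hDs, add_comm]
        simp
      simp only [Q, star_sub, hP, this]
    have hQ₁₀ : star (Q 1 0) = Q 0 1 := congrFun (congrFun hQ 0) 1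
    have hQ₀₁ : star (Q 0 1) = Q 1 0 := congrFun (congrFun hQ 1) 0
    -- The skew part of C is free for unitarity and adds [K, D] to Q. As D is diagonal, the
    -- off-diagonal entries of [K, D] are those of K times ∓(D₀₀ − D₁₁), and g inverts this gap.
    let K : SmoothMatrix := !![0, g * Q 0 1; -(g * Q 1 0), 0]
    have hK : star K = -K := by
      refine Matrix.ext fun i j => ?_
      fin_cases i <;> fin_cases j <;> simp [K, Matrix.star_apply, hg, hQ₁₀, hQ₀₁]
    let C : SmoothMatrix := K - (1 / 2 : ℂ) • S
    have hC : star C = -K - (1 / 2 : ℂ) • S := by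
      have : star ((1 / 2 : ℂ) • S) = (1 / 2 : ℂ) • S := by
        refine Matrix.ext fun i j => ?_
        rw [Matrix.star_apply, Matrix.smul_apply, star_smul_smooth, Matrix.smul_apply,
          ← Matrix.star_apply, hS]
        simp
      rw [star_sub, hK, this]
    let N : FormalMatrix := ofCoeff fun j => if j = k then C else 0
    have hN : VanishesBelow k N := fun j hj => by simp [N, hj.ne]
    have hNk : coeffM k N = C := by simp [N]
    have hU₀ : coeffM 0 (U * star U) = 1 := by rw [coeffM_zero_mul, coeffM_star, hU, hR]
    have hP₀ : coeffM 0 (U * T * star U) = D := by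
      rw [coeffM_zero_mul, coeffM_zero_mul, coeffM_star, hU, hD]
    have key := fun X j (hj : j ≤ k) => coeffM_conj_one_add (k := k) (by omega) hN X hj
    refine ⟨(1 + N) * U, ?_, fun j hj => ?_, fun j hj => ?_⟩
    · rw [coeffM_zero_mul, map_add, hN 0 (by omega), coeffM_zero_one, add_zero, one_mul, hU]
    · rw [star_mul, mul_assoc, ← mul_assoc U, ← mul_assoc (1 + N), map_sub, key _ _ (by omega),
        hU₀]
      rcases Nat.lt_or_ge j k with h | h
      · rw [hN j h, star_zero, mul_zero, zero_mul, add_zero, add_zero, ← map_sub]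
        exact hUU j h
      · obtain rfl : j = k := by omega
        rw [hNk, hC, coeffM_one (by omega)]
        change S + C * 1 + 1 * _ - 0 = 0
        simp only [C, mul_one, one_mul]
        module
    · have : (1 + N) * U * T * star ((1 + N) * U) = (1 + N) * (U * T * star U) * star (1 + N) := by
        rw [star_mul]
        simp only [mul_assoc]
      rw [this, key _ _ (by omega), hP₀]
      rcases Nat.lt_or_ge j k with h | h
      · rw [hN j h, star_zero, mul_zero, zero_mul, add_zero, add_zero]
        exact hUT j h
      · obtain rfl : j = k := by omega
        have e : P + C * D + D * star C = Q + (K * D - D * K) := by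
          rw [hC]
          simp only [C, Q, sub_mul, mul_sub, smul_mul_assoc, mul_smul_comm, mul_neg]
          module
        rw [hNk]
        change (P + C * D + D * star C) 0 1 = 0 ∧ (P + C * D + D * star C) 1 0 = 0
        rw [e]
        simp only [Matrix.add_apply, Matrix.sub_apply, Matrix.mul_apply, Fin.sum_univ_two, K,
          h₀₁, h₁₀]
        simp
        constructor
        · linear_combination -Q 0 1 * hgap
        · linear_combination -Q 1 0 * hgap

end FormalMatrix

/-! ### Formal projections: symmetries, uniqueness and existence -/

namespace FormalMatrix

open FormalSymbol (coeff)

/-- The anti-automorphism given by transposition and `ε ↦ -ε`. -/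
def flipTranspose (A : FormalMatrix) : FormalMatrix := (A.map FormalSymbol.flip)ᵀ

lemma flipTranspose_mul (A B : FormalMatrix) :
    flipTranspose (A * B) = flipTranspose B * flipTranspose A := by
  refine Matrix.ext fun i j => ?_
  simp only [flipTranspose, Matrix.transpose_apply, Matrix.map_apply, Matrix.mul_apply, map_sum,
    FormalSymbol.flip_mul]

lemma coeffM_flipTranspose (n : ℕ) (A : FormalMatrix) :
    coeffM n (flipTranspose A) = (-1 : ℂ) ^ n • (coeffM n A)ᵀ := rfl

/-- The series with the single term `A` at order zero. -/
def const (A : SmoothMatrix) : FormalMatrix := ofCoeff fun k => if k = 0 then A else 0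

lemma coeffM_const (n : ℕ) (A : SmoothMatrix) : coeffM n (const A) = if n = 0 then A else 0 := rfl

lemma star_const (A : SmoothMatrix) : star (const A) = const (star A) :=
  ext_coeffM fun n => by rw [coeffM_star, coeffM_const, coeffM_const]; split_ifs <;> simp

lemma flipTranspose_const (A : SmoothMatrix) : flipTranspose (const A) = const Aᵀ :=
  ext_coeffM fun n => by
    rw [coeffM_flipTranspose, coeffM_const, coeffM_const]
    split_ifs with h <;> simp [h]

lemma const_one : const 1 = 1 :=
  ext_coeffM fun n => by
    rw [coeffM_const]
    split_ifs with h
    · rw [h, coeffM_zero_one]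
    · rw [coeffM_one h]

/-- The partial sum `∑_{k ≤ n} εᵏ Aₖ`. -/
def trunc (n : ℕ) (A : FormalMatrix) : FormalMatrix :=
  ofCoeff fun k => if k ≤ n then coeffM k A else 0

lemma coeffM_trunc (n k : ℕ) (A : FormalMatrix) :
    coeffM k (trunc n A) = if k ≤ n then coeffM k A else 0 := rfl

lemma star_trunc (n : ℕ) (A : FormalMatrix) : star (trunc n A) = trunc n (star A) :=
  ext_coeffM fun k => by
    rw [coeffM_star, coeffM_trunc, coeffM_trunc]
    split_ifs <;> simp

lemma vanishesBelow_sub_trunc (n : ℕ) (A : FormalMatrix) : VanishesBelow (n + 1) (A - trunc n A) :=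
  fun k hk => by rw [map_sub, coeffM_trunc, if_pos (by omega), sub_self]

/-- `P` is, up to `O(ε^m)`, a projection with leading term `E` that commutes with `H`. -/
structure IsProjectionBelow (H : FormalMatrix) (E : SmoothMatrix) (m : ℕ) (P : FormalMatrix) :
    Prop where
  principal : coeffM 0 P = E
  idempotent : VanishesBelow m (P * P - P)
  commutes : VanishesBelow m (H * P - P * H)

/-- `P` is a projection with leading term `E` that commutes with `H`. -/
structure IsProjection (H : FormalMatrix) (E : SmoothMatrix) (P : FormalMatrix) : Prop where
  principal : coeffM 0 P = E
  idempotent : P * P = P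
  commutes : H * P = P * H

lemma IsProjection.below {H : FormalMatrix} {E : SmoothMatrix} {P : FormalMatrix}
    (h : IsProjection H E P) (m : ℕ) : IsProjectionBelow H E m P :=
  ⟨h.principal, fun k _ => by rw [h.idempotent, sub_self, map_zero],
    fun k _ => by rw [h.commutes, sub_self, map_zero]⟩

lemma IsProjectionBelow.mono {H : FormalMatrix} {E : SmoothMatrix} {P : FormalMatrix} {m m' : ℕ}
    (h : IsProjectionBelow H E m P) (hm : m' ≤ m) : IsProjectionBelow H E m' P :=
  ⟨h.principal, h.idempotent.mono hm, h.commutes.mono hm⟩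

/-- Let X be the first coefficient of the difference. Idempotency gives X = XE + EX, and commutation
with H gives [H_0, X] = 0, hence EX = XE by hypothesis. Multiplying X = 2EX by E yields EX = 0, so X
= 0. -/
lemma IsProjectionBelow.vanishesBelow_sub {H : FormalMatrix} {E : SmoothMatrix}
    (hE : E * E = E) (hH : ∀ X : SmoothMatrix, coeffM 0 H * X = X * coeffM 0 H → E * X = X * E)
    {m : ℕ} {P P' : FormalMatrix} (h : IsProjectionBelow H E m P)
    (h' : IsProjectionBelow H E m P') : VanishesBelow m (P - P') := by
  intro k
  induction k using Nat.strong_induction_on with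
  | _ k ih =>
    intro hk
    have hv : VanishesBelow k (P - P') := fun j hj => ih j hj (hj.trans hk)
    set X := coeffM k (P - P') with hX
    have h₁ : (P - P') * P + P' * (P - P') - (P - P') = (P * P - P) - (P' * P' - P') := by
      noncomm_ring
    have h₂ := congrArg (coeffM k) h₁
    rw [(h.idempotent.sub h'.idempotent) k hk, map_sub, map_add, hv.coeffM_mul, hv.coeffM_mul_left,
      ← hX, h.principal, h'.principal, sub_eq_zero] at h₂
    have h₃ : H * (P - P') - (P - P') * H = (H * P - P * H) - (H * P' - P' * H) := by
      noncomm_ring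
    have h₄ := congrArg (coeffM k) h₃
    rw [(h.commutes.sub h'.commutes) k hk, map_sub, hv.coeffM_mul, hv.coeffM_mul_left,
      ← hX, sub_eq_zero] at h₄
    have h₅ := hH X h₄
    rw [← h₅] at h₂
    have h₆ : E * X = 0 := by
      have := congrArg (E * ·) h₂
      simp only [mul_add, ← mul_assoc, hE] at this
      simpa using this
    rw [← h₂, h₆, add_zero]

lemma IsProjection.unique {H : FormalMatrix} {E : SmoothMatrix}
    (hE : E * E = E) (hH : ∀ X : SmoothMatrix, coeffM 0 H * X = X * coeffM 0 H → E * X = X * E)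
    {P P' : FormalMatrix} (h : IsProjection H E P) (h' : IsProjection H E P') : P = P' :=
  ext_coeffM fun n => sub_eq_zero.mp <| by
    rw [← map_sub]
    exact (h.below (n + 1)).vanishesBelow_sub hE hH (h'.below (n + 1)) n n.lt_succ_self

/-- The projection onto the first component. -/
def firstProj (α : Type*) [Zero α] [One α] : Matrix (Fin 2) (Fin 2) α := !![1, 0; 0, 0]

lemma firstProj_mul_self (α : Type*) [NonAssocSemiring α] :
    firstProj α * firstProj α = firstProj α := by
  refine Matrix.ext fun i j => ?_
  rw [Matrix.mul_apply, Fin.sum_univ_two]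
  fin_cases i <;> fin_cases j <;> simp [firstProj]

lemma coeffM_zero_firstProj : coeffM 0 (firstProj FormalSymbol) = firstProj SmoothSymbol := by
  refine Matrix.ext fun i j => ?_
  fin_cases i <;> fin_cases j <;> simp [coeffM_apply, firstProj, FormalSymbol.coeff_one]

lemma DiagonalBelow.commutator_firstProj {m : ℕ} {A : FormalMatrix} (hA : DiagonalBelow m A) :
    VanishesBelow m (A * firstProj FormalSymbol - firstProj FormalSymbol * A) := by
  intro k hk
  obtain ⟨h₁, h₂⟩ := hA k hk
  rw [coeffM_apply] at h₁ h₂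
  refine Matrix.ext fun i j => ?_
  rw [coeffM_apply, Matrix.sub_apply, Matrix.mul_apply, Matrix.mul_apply, Fin.sum_univ_two,
    Fin.sum_univ_two]
  fin_cases i <;> fin_cases j <;> simp [firstProj, h₁, h₂]

/-- Once U diagonalizes H to the given order, diag(1,0) nearly commutes with UHU*, and U* diag(1,0)
U is the approximate projection. The errors come from the unitarity defects and the remaining
off-diagonal entries. -/
lemma exists_isProjectionBelow {H : FormalMatrix} (hH : star H = H) {E R D : SmoothMatrix}
    (hR : R * star R = 1) (hR' : star R * R = 1)
    (hE : R * E * star R = firstProj SmoothSymbol) (hD : R * coeffM 0 H * star R = D)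
    (h₀₁ : D 0 1 = 0) (h₁₀ : D 1 0 = 0) {g : SmoothSymbol} (hg : star g = g)
    (hgap : g * (D 0 0 - D 1 1) = 1) (m : ℕ) :
    ∃ P : FormalMatrix, IsProjectionBelow H E m P := by
  obtain ⟨U, hU, hUU, hUH⟩ := exists_diagonalizing_unitary hH hR hD h₀₁ h₁₀ hg hgap m
  have hUU' := vanishesBelow_star_mul_self hR' hU hUU
  set F := firstProj FormalSymbol
  have hF : F * F = F := firstProj_mul_self _
  refine ⟨star U * F * U, ?_, VanishesBelow.mono (m := m + 1) ?_ (by omega),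
    VanishesBelow.mono (m := m + 1) ?_ (by omega)⟩
  · rw [coeffM_zero_mul, coeffM_zero_mul, coeffM_star, hU, coeffM_zero_firstProj, ← hE]
    calc star R * (R * E * star R) * R = (star R * R) * E * (star R * R) := by
          simp only [mul_assoc]
      _ = E := by rw [hR', one_mul, mul_one]
  · have : star U * F * U * (star U * F * U) - star U * F * U =
        star U * F * (U * star U - 1) * (F * U) + star U * (F * F - F) * U := by noncomm_ring
    rw [this, hF, sub_self, mul_zero, zero_mul, add_zero]
    exact (hUU.mul_left _).mul_right _
  · have : H * (star U * F * U) - star U * F * U * H =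
        star U * ((U * H * star U) * F - F * (U * H * star U)) * U -
          (star U * U - 1) * H * (star U * F * U) + star U * F * U * H * (star U * U - 1) := by
      noncomm_ring
    rw [this]
    refine ((VanishesBelow.mul_right (VanishesBelow.mul_left ?_ _) _).sub ?_).add ?_
    · exact hUH.commutator_firstProj
    · exact (hUU'.mul_right _).mul_right _
    · exact hUU'.mul_left _

/-- Existence of the formal projection onto the first eigenspace of a self-adjoint series with
gapped leading term. -/
theorem exists_isProjection {H : FormalMatrix} (hH : star H = H) {E R D : SmoothMatrix}
    (hR : R * star R = 1) (hR' : star R * R = 1)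
    (hE : R * E * star R = firstProj SmoothSymbol) (hD : R * coeffM 0 H * star R = D)
    (h₀₁ : D 0 1 = 0) (h₁₀ : D 1 0 = 0) {g : SmoothSymbol} (hg : star g = g)
    (hgap : g * (D 0 0 - D 1 1) = 1) (hEE : E * E = E)
    (hcomm : ∀ X : SmoothMatrix, coeffM 0 H * X = X * coeffM 0 H → E * X = X * E) :
    ∃ P : FormalMatrix, IsProjection H E P := by
  choose Q hQ using exists_isProjectionBelow hH hR hR' hE hD h₀₁ h₁₀ hg hgap
  -- By uniqueness below order m the approximate projections agree wherever they are both accurate,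
  -- so their coefficients fit into one series; `Q (k + 1)` is the first one accurate at order k.
  let P : FormalMatrix := ofCoeff fun k => coeffM k (Q (k + 1))
  have hP : ∀ m, VanishesBelow m (P - Q m) := fun m k hk => by
    have h := ((hQ (k + 1)).vanishesBelow_sub hEE hcomm ((hQ m).mono hk)) k k.lt_succ_self
    rwa [map_sub] at h ⊢
  have hv : ∀ A : FormalMatrix, (∀ m, VanishesBelow m A) → A = 0 := fun A hA =>
    ext_coeffM fun n => by rw [hA (n + 1) n n.lt_succ_self, map_zero]
  refine ⟨P, (hQ 1).principal, sub_eq_zero.mp (hv _ fun m => ?_), sub_eq_zero.mp (hv _ fun m => ?_)⟩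
  · have : P * P - P = (P - Q m) * P + Q m * (P - Q m) + (Q m * Q m - Q m) - (P - Q m) := by
      noncomm_ring
    rw [this]
    exact ((((hP m).mul_right _).add ((hP m).mul_left _)).add (hQ m).idempotent).sub (hP m)
  · have : H * P - P * H = H * (P - Q m) - (P - Q m) * H + (H * Q m - Q m * H) := by
      noncomm_ring
    rw [this]
    exact (((hP m).mul_left _).sub ((hP m).mul_right _)).add (hQ m).commutes

/-! ### Off-diagonal part of the transformed Hamiltonian -/

/-- If `U` diagonalizes an approximation `T` of a projection commuting with `H`, then the
off-diagonal part of `U H U*` starts at the order of the approximation, with a coefficient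
determined by the first term of the error. -/
theorem offDiagonal_conj {H P T U : FormalMatrix} {n : ℕ} (hP : H * P = P * H)
    (hT : VanishesBelow n (P - T)) (hU : VanishesBelow (n + 1) (star U * U - 1))
    (hUT : DiagonalBelow (n + 1) (U * T * star U))
    (hUT₀ : coeffM 0 (U * T * star U) = firstProj SmoothSymbol) {C : SmoothMatrix}
    (hC : coeffM 0 U * (coeffM 0 H * coeffM n (P - T) - coeffM n (P - T) * coeffM 0 H) *
      star (coeffM 0 U) = C) :
    DiagonalBelow n (U * H * star U) ∧ coeffM n (U * H * star U) 0 1 = C 0 1 ∧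
      coeffM n (U * H * star U) 1 0 = -C 1 0 := by
  set G := U * H * star U
  set F := U * T * star U
  -- Inserting U*U − 1 reduces [G, F] to U[H, T]U*, which equals −U[H, P − T]U* because P commutes
  -- with H. The two defect terms are beyond order n, so the first contribution is −C.
  have hGF : G * F - F * G = U * H * (star U * U - 1) * T * star U -
      U * T * (star U * U - 1) * H * star U - U * (H * (P - T) - (P - T) * H) * star U := by
    have : U * (H * (P - T) - (P - T) * H) * star U =
      U * (H * P - P * H) * star U - U * (H * T - T * H) * star U := by noncomm_ring
    rw [this, hP, sub_self]
    simp only [G, F]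
    noncomm_ring
  have hHT : VanishesBelow n (H * (P - T) - (P - T) * H) := (hT.mul_left _).sub (hT.mul_right _)
  have hcoeff : ∀ k ≤ n, coeffM k (G * F - F * G) = if k = n then -C else 0 := by
    intro k hk
    rw [hGF, map_sub, map_sub, ((hU.mul_left _).mul_right _).mul_right _ k (by omega),
      ((hU.mul_left _).mul_right _).mul_right _ k (by omega)]
    split_ifs with h
    · subst h
      rw [(hHT.mul_left _).coeffM_mul, hHT.coeffM_mul_left, map_sub, hT.coeffM_mul_left,
        hT.coeffM_mul, coeffM_star, hC]
      simp
    · rw [(hHT.mul_left _).mul_right _ k (by omega)]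
      simp
  have hF₀₀ : coeff 0 (F 0 0) = 1 := congrFun (congrFun hUT₀ 0) 0
  have hF₁₁ : coeff 0 (F 1 1) = 0 := congrFun (congrFun hUT₀ 1) 1
  have hF₀₁ : ∀ k < n + 1, coeff k (F 0 1) = 0 := fun k hk => (hUT k hk).1
  have hF₁₀ : ∀ k < n + 1, coeff k (F 1 0) = 0 := fun k hk => (hUT k hk).2
  -- To leading order F is diag(1,0), and its off-diagonal entries vanish through order n. Hence [G,
  -- F] has off-diagonal entries −G₀₁ and G₁₀ at the first order where these can be nonzero; the
  -- induction keeps lower coefficients of G from interfering.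
  have main : ∀ k ≤ n, coeff k (G 0 1) = -coeffM k (G * F - F * G) 0 1 ∧
      coeff k (G 1 0) = coeffM k (G * F - F * G) 1 0 := by
    intro k
    induction k using Nat.strong_induction_on with
    | _ k ih =>
      intro hk
      have hG₀₁ : ∀ j < k, coeff j (G 0 1) = 0 := fun j hj => by
        rw [(ih j hj (by omega)).1, hcoeff j (by omega), if_neg (by omega)]
        simp
      have hG₁₀ : ∀ j < k, coeff j (G 1 0) = 0 := fun j hj => by
        rw [(ih j hj (by omega)).2, hcoeff j (by omega), if_neg (by omega)]
        simp
      have hf₀₁ : ∀ j < k, coeff j (F 0 1) = 0 := fun j hj => hF₀₁ j (by omega)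
      have hf₁₀ : ∀ j < k, coeff j (F 1 0) = 0 := fun j hj => hF₁₀ j (by omega)
      constructor
      · simp only [coeffM_apply, Matrix.sub_apply, Matrix.mul_apply, Fin.sum_univ_two, map_sub,
          map_add]
        rw [FormalSymbol.coeff_mul_of_right hf₀₁, FormalSymbol.coeff_mul_of_left hf₀₁,
          FormalSymbol.coeff_mul_of_left hG₀₁, FormalSymbol.coeff_mul_of_right hG₀₁, hF₀₀, hF₁₁,
          hF₀₁ k (by omega)]
        ring
      · simp only [coeffM_apply, Matrix.sub_apply, Matrix.mul_apply, Fin.sum_univ_two, map_sub,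
          map_add]
        rw [FormalSymbol.coeff_mul_of_right hf₁₀, FormalSymbol.coeff_mul_of_left hf₁₀,
          FormalSymbol.coeff_mul_of_left hG₁₀, FormalSymbol.coeff_mul_of_right hG₁₀, hF₀₀, hF₁₁,
          hF₁₀ k (by omega)]
        ring
  refine ⟨fun k hk => ?_, ?_, ?_⟩
  · have h := main k hk.le
    rw [hcoeff k hk.le, if_neg hk.ne] at h
    exact ⟨h.1.trans (by simp), h.2.trans (by simp)⟩
  · refine (main n le_rfl).1.trans ?_
    rw [hcoeff n le_rfl, if_pos rfl]
    simp
  · refine (main n le_rfl).2.trans ?_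
    rw [hcoeff n le_rfl, if_pos rfl]
    simp

/-! ### Translation to series of symbols -/

/-- The underlying series of matrix symbols. -/
def toSeries (A : FormalMatrix) : SymbolSeries := fun n =>
  .of fun i j => (coeffM n A i j : ScalarSymbol)

lemma toSeries_apply (A : FormalMatrix) (n : ℕ) (i j : Fin 2) :
    toSeries A n i j = (coeffM n A i j : ScalarSymbol) := rfl

lemma toSeries_injective : Function.Injective toSeries := fun _ _ h =>
  ext_coeffM fun n => Matrix.ext fun i j => SmoothSymbol.val_injective <|
    congrFun (congrFun (congrFun h n) i) j

lemma toSeries_smooth (A : FormalMatrix) (n : ℕ) (i j : Fin 2) :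
    ContDiff ℝ ∞ (toSeries A n i j) := (coeffM n A i j).contDiff

lemma exists_toSeries_eq {A : SymbolSeries} (hA : ∀ k i j, ContDiff ℝ ∞ (A k i j)) :
    ∃ B : FormalMatrix, toSeries B = A :=
  ⟨ofCoeff fun n => .of fun i j => .mk (A n i j) (hA n i j), rfl⟩

lemma toSeries_mul (A B : FormalMatrix) :
    toSeries (A * B) = starProd (toSeries A) (toSeries B) := by
  funext n
  refine Matrix.ext fun i j => ?_
  simp only [toSeries_apply, coeffM_apply, starProd, Matrix.sum_apply, moyalMat, Matrix.of_apply,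
    Matrix.mul_apply, map_sum, FormalSymbol.coeff_mul, coe_moyal]
  rw [Finset.sum_comm]
  exact Finset.sum_congr rfl fun u _ => Finset.sum_comm

lemma toSeries_star (A : FormalMatrix) : toSeries (star A) = adjSeries (toSeries A) := rfl

lemma toSeries_trunc (n : ℕ) (A : FormalMatrix) :
    toSeries (trunc n A) = truncSeries n (toSeries A) := by
  funext k
  refine Matrix.ext fun i j => ?_
  rw [toSeries_apply, coeffM_trunc, truncSeries]
  split_ifs <;> rfl

lemma toSeries_const (A : SmoothMatrix) :
    toSeries (const A) = constSeries (A.map SmoothSymbol.val) := by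
  funext k
  refine Matrix.ext fun i j => ?_
  rw [toSeries_apply, coeffM_const, constSeries]
  split_ifs <;> rfl

end FormalMatrix

/-! ### Functions of position, momenta and the kinetic energy -/

/-- A smooth real function of position, as a smooth symbol. -/
def posSymbol (f : Plane → ℝ) (hf : ContDiff ℝ ∞ f) : SmoothSymbol :=
  .mk (onQ f) (Complex.ofRealCLM.contDiff.comp (hf.comp contDiff_snd))

@[simp]
lemma coe_posSymbol (f : Plane → ℝ) (hf : ContDiff ℝ ∞ f) :
    (posSymbol f hf : ScalarSymbol) = onQ f := rfl

lemma onQ_injective : Function.Injective onQ := fun _ _ h => funext fun q =>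
  Complex.ofReal_injective (congrFun h (0, q))

lemma contDiff_posDeriv (i : Fin 2) {f : Plane → ℝ} (hf : ContDiff ℝ ∞ f) :
    ContDiff ℝ ∞ (posDeriv i f) :=
  (hf.fderiv_right (m := ∞) (by simp)).clm_apply contDiff_const

lemma directional_posSymbol (v : PhaseSpace) (f : Plane → ℝ) (hf : ContDiff ℝ ∞ f)
    (z : PhaseSpace) :
    (directional v (posSymbol f hf) : ScalarSymbol) z = (fderiv ℝ f z.2 v.2 : ℂ) := by
  have h₁ : HasFDerivAt f (fderiv ℝ f z.2) z.2 := (hf.differentiable (by simp) _).hasFDerivAt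
  have h₂ := Complex.ofRealCLM.hasFDerivAt.comp z (h₁.comp z hasFDerivAt_snd)
  exact congrArg (fun L => L v) h₂.fderiv

lemma derivP_posSymbol (i : Fin 2) (f : Plane → ℝ) (hf : ContDiff ℝ ∞ f) :
    derivP i (posSymbol f hf) = 0 := by
  ext z
  rw [derivP, directional_posSymbol]
  simp

lemma derivQ_posSymbol (i : Fin 2) (f : Plane → ℝ) (hf : ContDiff ℝ ∞ f) :
    derivQ i (posSymbol f hf) = posSymbol (posDeriv i f) (contDiff_posDeriv i hf) := by
  ext z
  rw [derivQ, directional_posSymbol]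
  rfl

lemma star_posSymbol (f : Plane → ℝ) (hf : ContDiff ℝ ∞ f) :
    star (posSymbol f hf) = posSymbol f hf := by
  ext z
  simp [coe_star, onQ]

lemma traceCoeff_succ_left (f : Plane → ℝ) (m n : ℕ) :
    traceCoeff f (m + 1, n) = posDeriv 0 (traceCoeff f (m, n)) :=
  Function.iterate_succ_apply' _ _ _

lemma contDiff_traceCoeff {f : Plane → ℝ} (hf : ContDiff ℝ ∞ f) (α : ℕ × ℕ) :
    ContDiff ℝ ∞ (traceCoeff f α) := by
  have h : ∀ i n (g : Plane → ℝ), ContDiff ℝ ∞ g → ContDiff ℝ ∞ ((posDeriv i)^[n] g) := by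
    intro i n
    induction n with
    | zero => exact fun g hg => hg
    | succ n ih => exact fun g hg => ih _ (contDiff_posDeriv i hg)
  exact h 0 _ _ (h 1 _ _ hf)

lemma multiQ_posSymbol (α : ℕ × ℕ) (f : Plane → ℝ) (hf : ContDiff ℝ ∞ f) :
    multiQ α (posSymbol f hf) = posSymbol (traceCoeff f α) (contDiff_traceCoeff hf α) := by
  apply SmoothSymbol.val_injective
  have h : ∀ i n (g : Plane → ℝ), ContDiff ℝ ∞ g →
      ContDiff ℝ ∞ ((posDeriv i)^[n] g) ∧ (dq i)^[n] (onQ g) = onQ ((posDeriv i)^[n] g) := by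
    intro i n
    induction n with
    | zero => exact fun g hg => ⟨hg, rfl⟩
    | succ n ih =>
      intro g hg
      rw [Function.iterate_succ_apply, Function.iterate_succ_apply]
      refine ⟨(ih _ (contDiff_posDeriv i hg)).1, ?_⟩
      rw [← (ih _ (contDiff_posDeriv i hg)).2]
      exact congrArg _ (congrArg SmoothSymbol.val (derivQ_posSymbol i g hg))
  rw [coe_multiQ, coe_posSymbol, coe_posSymbol, dqMulti, traceCoeff, (h 1 α.2 f hf).2,
    (h 0 α.1 _ (h 1 α.2 f hf).1).2]

/-- The new derivative has to pass the iterated ∂_{q_1}, so unlike `traceCoeff_succ_left` this uses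
smoothness; it is transferred from the commuting operators `multiQ` and `derivQ`. -/
lemma traceCoeff_succ_right {f : Plane → ℝ} (hf : ContDiff ℝ ∞ f) (m n : ℕ) :
    traceCoeff f (m, n + 1) = posDeriv 1 (traceCoeff f (m, n)) := by
  apply onQ_injective
  have h := congrArg (fun L => L (posSymbol f hf)) (multiQ_succ_right m n)
  simp only [(commute_multiQ_derivQ _ _).eq] at h
  simp only [Module.End.mul_apply, multiQ_posSymbol, derivQ_posSymbol] at h
  exact congrArg SmoothSymbol.val h

/-- Symbols that do not depend on the momentum. -/
def MomentumFree (f : SmoothSymbol) : Prop := ∀ i, derivP i f = 0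

lemma momentumFree_posSymbol (f : Plane → ℝ) (hf : ContDiff ℝ ∞ f) :
    MomentumFree (posSymbol f hf) := fun i => derivP_posSymbol i f hf

lemma derivP_mul (i : Fin 2) (a b : SmoothSymbol) :
    derivP i (a * b) = derivP i a * b + a * derivP i b := directional_mul _ a b

lemma derivQ_mul (i : Fin 2) (a b : SmoothSymbol) :
    derivQ i (a * b) = derivQ i a * b + a * derivQ i b := directional_mul _ a b

namespace MomentumFree

variable {f g : SmoothSymbol}

lemma multiQ (hf : MomentumFree f) (β : ℕ × ℕ) : MomentumFree (multiQ β f) := fun i => by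
  have h := congrArg (fun L => L f) (commute_multiQ_derivP β i).eq
  simp only [Module.End.mul_apply, hf i, map_zero] at h
  exact h.symm

lemma multiP_eq_zero (hf : MomentumFree f) {α : ℕ × ℕ} (hα : α ≠ (0, 0)) : multiP α f = 0 := by
  obtain ⟨m, n⟩ := α
  rcases m with _ | m
  · rcases n with _ | n
    · exact absurd rfl hα
    · rw [multiP_succ_right, Module.End.mul_apply, hf, map_zero]
  · rw [multiP_succ_left, Module.End.mul_apply, hf, map_zero]

lemma multiP_mul (hf : MomentumFree f) (α : ℕ × ℕ) (a : SmoothSymbol) :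
    multiP α (f * a) = f * multiP α a := by
  have h : ∀ (i : Fin 2) (n : ℕ) (a : SmoothSymbol),
      (derivP i ^ n) (f * a) = f * (derivP i ^ n) a := by
    intro i n
    induction n with
    | zero => simp
    | succ n ih =>
      intro a
      rw [pow_succ, Module.End.mul_apply, Module.End.mul_apply, derivP_mul, hf, zero_mul, zero_add,
        ih]
  simp only [multiP, Module.End.mul_apply, h]

lemma mul (hf : MomentumFree f) (hg : MomentumFree g) : MomentumFree (f * g) := fun i => by
  rw [derivP_mul, hf, hg, zero_mul, mul_zero, add_zero]

lemma add (hf : MomentumFree f) (hg : MomentumFree g) : MomentumFree (f + g) := fun i => by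
  rw [map_add, hf, hg, add_zero]

lemma neg (hf : MomentumFree f) : MomentumFree (-f) := fun i => by
  rw [map_neg, hf, neg_zero]

lemma sub (hf : MomentumFree f) (hg : MomentumFree g) : MomentumFree (f - g) := fun i => by
  rw [map_sub, hf, hg, sub_zero]

lemma smul (c : ℂ) (hf : MomentumFree f) : MomentumFree (c • f) := fun i => by
  rw [map_smul, hf, smul_zero]

lemma one : MomentumFree 1 := fun _ => directional_one _

lemma zero : MomentumFree 0 := fun _ => map_zero _

/-- Every term that differentiates f in p dies, leaving all p-derivatives on the other factor and
the sign (−1)^l of the terms ∂_q ⊗ ∂_p. -/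
lemma moyal_eq (hf : MomentumFree f) (l : ℕ) (a : SmoothSymbol) :
    moyal l f a = (1 / (2 * Complex.I) ^ l : ℂ) •
      ∑ β ∈ Finset.HasAntidiagonal.antidiagonal l,
        (1 / (β.1 ! * β.2 ! : ℂ)) • ((-1 : ℂ) ^ l • (_root_.multiQ β f * multiP β a)) := by
  rw [_root_.moyal_eq, moyalSum, Finset.sum_eq_single (0, l)]
  · congr 1
    rw [show Finset.HasAntidiagonal.antidiagonal ((0, l) : ℕ × ℕ).1 = {(0, 0)} from rfl,
      Finset.sum_singleton]
    refine Finset.sum_congr rfl fun β _ => ?_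
    rw [smul_smul]
    simp [multiP, _root_.multiQ]
    ring_nf
  · rintro ⟨i, j⟩ hij hne
    simp only [Finset.HasAntidiagonal.mem_antidiagonal, ne_eq, Prod.mk.injEq] at hij hne
    refine Finset.sum_eq_zero fun α hα => Finset.sum_eq_zero fun β _ => ?_
    rw [(hf.multiQ β).multiP_eq_zero, zero_mul, smul_zero]
    rintro rfl
    simp only [Finset.HasAntidiagonal.mem_antidiagonal] at hα
    omega
  · simp

end MomentumFree

/-- The momentum `pᵢ`. -/
def momentum (i : Fin 2) : SmoothSymbol :=
  .mk (fun z => (z.1 i : ℂ))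
    (Complex.ofRealCLM.contDiff.comp ((contDiff_apply ℝ ℝ i).comp contDiff_fst))

lemma coe_momentum (i : Fin 2) (z : PhaseSpace) : (momentum i : ScalarSymbol) z = z.1 i := rfl

lemma directional_momentum (v : PhaseSpace) (i : Fin 2) :
    directional v (momentum i) = algebraMap ℂ SmoothSymbol (v.1 i) := by
  ext z
  exact congrArg (fun L => L v) (Complex.ofRealCLM.comp ((ContinuousLinearMap.proj (R := ℝ) i).comp
    (ContinuousLinearMap.fst ℝ Plane Plane))).fderiv

lemma derivP_momentum (i j : Fin 2) : derivP i (momentum j) = if i = j then 1 else 0 := by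
  rw [derivP, directional_momentum]
  by_cases h : i = j
  · simp [h]
  · simp [h, Ne.symm h]

lemma derivQ_momentum (i j : Fin 2) : derivQ i (momentum j) = 0 := by
  rw [derivQ, directional_momentum]
  simp

lemma star_momentum (i : Fin 2) : star (momentum i) = momentum i := by
  ext z
  simp [coe_star, coe_momentum]

/-- The kinetic energy as a smooth symbol. -/
def kineticEnergy : SmoothSymbol := (1 / 2 : ℂ) • ∑ i, momentum i * momentum i

lemma coe_kineticEnergy : (kineticEnergy : ScalarSymbol) = kinetic := by
  funext z
  simp [kineticEnergy, kinetic, coe_momentum]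
  ring

lemma star_kineticEnergy : star kineticEnergy = kineticEnergy := by
  simp [kineticEnergy, star_smul_smooth, star_momentum]

lemma derivP_kineticEnergy (i : Fin 2) : derivP i kineticEnergy = momentum i := by
  simp only [kineticEnergy, map_smul, map_sum, derivP_mul, derivP_momentum]
  simp [Finset.sum_add_distrib]
  module

lemma derivQ_kineticEnergy (i : Fin 2) : derivQ i kineticEnergy = 0 := by
  simp [kineticEnergy, derivQ_mul, derivQ_momentum]

/-- `p · ∇_q` on smooth symbols. -/
def transportS (a : SmoothSymbol) : SmoothSymbol := ∑ i, momentum i * derivQ i a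

lemma coe_transportS (a : SmoothSymbol) : (transportS a : ScalarSymbol) = transport a := by
  funext z
  simp [transportS, transport, coe_momentum, coe_derivQ]

lemma transportS_mul (a b : SmoothSymbol) :
    transportS (a * b) = transportS a * b + a * transportS b := by
  simp only [transportS, derivQ_mul, Fin.sum_univ_two]
  ring

lemma transportS_add (a b : SmoothSymbol) : transportS (a + b) = transportS a + transportS b := by
  simp only [transportS, map_add, Fin.sum_univ_two]
  ring

lemma transportS_sub (a b : SmoothSymbol) : transportS (a - b) = transportS a - transportS b := by
  simp only [transportS, map_sub, Fin.sum_univ_two]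
  ring

lemma transportS_neg (a : SmoothSymbol) : transportS (-a) = -transportS a := by
  simp only [transportS, map_neg, Fin.sum_univ_two]
  ring

lemma moyal_momentum (l : ℕ) (i : Fin 2) (a : SmoothSymbol) : moyal (l + 2) (momentum i) a = 0 := by
  rw [moyal_succ, Finset.sum_eq_zero, smul_zero]
  intro j _
  rw [derivP_momentum, derivQ_momentum, map_zero, LinearMap.zero_apply, sub_zero]
  split_ifs
  · exact moyal_succ_one_left _ _
  · rw [map_zero, LinearMap.zero_apply]

lemma moyal_one_kineticEnergy (a : SmoothSymbol) :
    moyal 1 kineticEnergy a = (1 / (2 * Complex.I) : ℂ) • transportS a := by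
  rw [moyal_succ]
  simp [derivP_kineticEnergy, derivQ_kineticEnergy, moyal_zero, transportS]

lemma moyal_kineticEnergy (l : ℕ) (a : SmoothSymbol) : moyal (l + 3) kineticEnergy a = 0 := by
  rw [moyal_succ, Finset.sum_eq_zero, smul_zero]
  intro j _
  rw [derivP_kineticEnergy, derivQ_kineticEnergy, moyal_momentum, map_zero, LinearMap.zero_apply,
    sub_zero]

/-- In the commutator even Moyal orders cancel and odd ones double. Since the kinetic energy is
quadratic, orders from 3 on vanish, so only the Poisson bracket at order 1 remains and the result is
exact. -/
lemma sum_commutator_kineticEnergy (n : ℕ) (f : ℕ → SmoothSymbol) :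
    ∑ u ∈ Finset.HasAntidiagonal.antidiagonal (n + 1),
      (moyal u.1 kineticEnergy (f u.2) - moyal u.1 (f u.2) kineticEnergy) =
      (1 / Complex.I) • transportS (f n) := by
  rw [Finset.sum_eq_single (1, n)]
  · rw [moyal_swap 1 kineticEnergy, moyal_one_kineticEnergy, smul_smul, ← sub_smul]
    congr 1
    field_simp
    norm_num
  · rintro ⟨i, j⟩ hij hne
    simp only [Finset.HasAntidiagonal.mem_antidiagonal, ne_eq, Prod.mk.injEq] at hij hne
    rw [moyal_swap i kineticEnergy]
    match i, hij, hne with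
    | 0, _, _ => simp
    | 1, hij, hne => omega
    | 2, _, _ => simp
    | i + 3, _, _ => simp [moyal_kineticEnergy]
  · intro h
    simp [add_comm] at h

/-! ### Expansion of the commutator with the Hamiltonian -/

namespace FormalSymbol

lemma coeff_const_mul {f : FormalSymbol} (hf : ∀ k, k ≠ 0 → coeff k f = 0) (n : ℕ)
    (g : FormalSymbol) : coeff n (f * g) =
      ∑ u ∈ Finset.HasAntidiagonal.antidiagonal n, moyal u.1 (coeff 0 f) (coeff u.2 g) := by
  rw [coeff_mul]
  refine Finset.sum_congr rfl fun u _ => ?_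
  rw [Finset.sum_eq_single (0, u.2)]
  · rintro ⟨i, j⟩ hij hne
    simp only [Finset.HasAntidiagonal.mem_antidiagonal, ne_eq, Prod.mk.injEq] at hij hne
    rw [hf i (by omega), map_zero, LinearMap.zero_apply]
  · simp

lemma coeff_mul_const {f : FormalSymbol} (hf : ∀ k, k ≠ 0 → coeff k f = 0) (n : ℕ)
    (g : FormalSymbol) : coeff n (g * f) =
      ∑ u ∈ Finset.HasAntidiagonal.antidiagonal n, moyal u.1 (coeff u.2 g) (coeff 0 f) := by
  rw [coeff_mul]
  refine Finset.sum_congr rfl fun u _ => ?_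
  rw [Finset.sum_eq_single (u.2, 0)]
  · rintro ⟨i, j⟩ hij hne
    simp only [Finset.HasAntidiagonal.mem_antidiagonal, ne_eq, Prod.mk.injEq] at hij hne
    rw [hf j (by omega), map_zero]
  · simp

end FormalSymbol

namespace FormalMatrix

open FormalSymbol (coeff)

lemma coeff_const_apply (A : SmoothMatrix) (i j : Fin 2) (k : ℕ) :
    coeff k (const A i j) = if k = 0 then A i j else 0 := by
  rw [← coeffM_apply, coeffM_const]
  split_ifs <;> rfl

lemma coeffM_const_mul (A : SmoothMatrix) (P : FormalMatrix) (n : ℕ) (i j : Fin 2) :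
    coeffM n (const A * P) i j = ∑ u ∈ Finset.HasAntidiagonal.antidiagonal n,
      ∑ t, moyal u.1 (A i t) (coeffM u.2 P t j) := by
  rw [coeffM_apply, Matrix.mul_apply, map_sum, Finset.sum_comm]
  refine Finset.sum_congr rfl fun t _ => ?_
  rw [FormalSymbol.coeff_const_mul fun k hk => by rw [coeff_const_apply, if_neg hk],
    coeff_const_apply, if_pos rfl]
  rfl

lemma coeffM_mul_const (A : SmoothMatrix) (P : FormalMatrix) (n : ℕ) (i j : Fin 2) :
    coeffM n (P * const A) i j = ∑ u ∈ Finset.HasAntidiagonal.antidiagonal n,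
      ∑ t, moyal u.1 (coeffM u.2 P i t) (A t j) := by
  rw [coeffM_apply, Matrix.mul_apply, map_sum, Finset.sum_comm]
  refine Finset.sum_congr rfl fun t _ => ?_
  rw [FormalSymbol.coeff_mul_const fun k hk => by rw [coeff_const_apply, if_neg hk],
    coeff_const_apply, if_pos rfl]
  rfl

/-- The commutator of `|p|²/2 + W(q)` with a series, order by order. -/
lemma coeffM_commutator (W : SmoothMatrix) (hW : ∀ i j, MomentumFree (W i j)) (P : FormalMatrix)
    (n : ℕ) :
    coeffM (n + 1) (const (kineticEnergy • 1 + W) * P - P * const (kineticEnergy • 1 + W)) =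
      (1 / Complex.I) • (coeffM n P).map transportS +
      ∑ u ∈ Finset.HasAntidiagonal.antidiagonal (n + 1), (1 / (2 * Complex.I) ^ u.1 : ℂ) •
        ∑ β ∈ Finset.HasAntidiagonal.antidiagonal u.1, (1 / (β.1 ! * β.2 ! : ℂ)) •
          ((-1 : ℂ) ^ u.1 • (W.map (multiQ β) * (coeffM u.2 P).map (multiP β)) -
            (coeffM u.2 P).map (multiP β) * W.map (multiQ β)) := by
  refine Matrix.ext fun i j => ?_
  -- With W as the right factor the sign from exchanging the factors cancels the (−1)^l of the
  -- momentum-free formula. This asymmetry between left and right is what later produces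
  -- anticommutators.
  have hswap : ∀ (l : ℕ) (a : SmoothSymbol) (s t : Fin 2), moyal l a (W s t) =
      (1 / (2 * Complex.I) ^ l : ℂ) • ∑ β ∈ Finset.HasAntidiagonal.antidiagonal l,
        (1 / (β.1 ! * β.2 ! : ℂ)) • (multiP β a * multiQ β (W s t)) := by
    intro l a s t
    rw [moyal_swap, (hW s t).moyal_eq, smul_comm, Finset.smul_sum]
    congr 1
    refine Finset.sum_congr rfl fun β _ => ?_
    have h : (-1 : ℂ) ^ l * (-1) ^ l = 1 := by rw [← mul_pow]; simp
    rw [mul_comm (multiQ β _), smul_smul, smul_smul]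
    congr 1
    linear_combination (1 / (β.1 ! * β.2 ! : ℂ)) * h
  rw [map_sub, Matrix.sub_apply, coeffM_const_mul, coeffM_mul_const, ← Finset.sum_sub_distrib,
    Matrix.add_apply, Matrix.smul_apply, Matrix.map_apply,
    ← sum_commutator_kineticEnergy n (fun k => coeffM k P i j), Matrix.sum_apply,
    ← Finset.sum_add_distrib]
  refine Finset.sum_congr rfl fun u _ => ?_
  have hk : ∀ i t : Fin 2, (kineticEnergy • (1 : SmoothMatrix) + W) i t =
      (if i = t then kineticEnergy else 0) + W i t := by
    intro i t
    simp [Matrix.one_apply]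
  have h₁ : ∑ t, moyal u.1 ((kineticEnergy • (1 : SmoothMatrix) + W) i t) (coeffM u.2 P t j) =
      moyal u.1 kineticEnergy (coeffM u.2 P i j) +
        ∑ t, moyal u.1 (W i t) (coeffM u.2 P t j) := by
    simp only [hk, map_add, LinearMap.add_apply, Finset.sum_add_distrib]
    congr 1
    rw [Finset.sum_eq_single i (fun t _ ht => by simp [Ne.symm ht]) (by simp), if_pos rfl]
  have h₂ : ∑ t, moyal u.1 (coeffM u.2 P i t) ((kineticEnergy • (1 : SmoothMatrix) + W) t j) =
      moyal u.1 (coeffM u.2 P i j) kineticEnergy +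
        ∑ t, moyal u.1 (coeffM u.2 P i t) (W t j) := by
    simp only [hk, map_add, Finset.sum_add_distrib]
    congr 1
    rw [Finset.sum_eq_single j (fun t _ ht => by simp [ht]) (by simp), if_pos rfl]
  rw [h₁, h₂, add_sub_add_comm]
  congr 1
  simp only [(hW _ _).moyal_eq, hswap, ← Finset.smul_sum, ← smul_sub, Matrix.smul_apply,
    Matrix.sum_apply]
  congr 1
  rw [Finset.sum_comm, Finset.sum_comm (s := Finset.univ), ← Finset.sum_sub_distrib]
  refine Finset.sum_congr rfl fun β _ => ?_
  simp only [← Finset.smul_sum, ← smul_sub, Matrix.sub_apply, Matrix.smul_apply, Matrix.mul_apply,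
    Matrix.map_apply]

end FormalMatrix

/-- `momentumSum` on smooth symbols. -/
def momentumSumS (n : ℕ) (F : ℕ → ℕ × ℕ → SmoothSymbol) : SmoothSymbol :=
  ∑ j ∈ Finset.Icc 1 n, (1 / ((2 * Complex.I) ^ j * j !) : ℂ) •
    ∑ α ∈ Finset.HasAntidiagonal.antidiagonal j, (j.choose α.1 : ℂ) • multiP α (F j α)

lemma coe_momentumSumS (n : ℕ) (F : ℕ → ℕ × ℕ → SmoothSymbol) :
    (momentumSumS n F : ScalarSymbol) = momentumSum n fun j α => (F j α : ScalarSymbol) := by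
  simp only [momentumSumS, momentumSum, map_sum, map_smul, coe_multiP]

/-- Moyal order 0 carries no derivative and isolates the unknown of order n + 1. Order n + 1 pairs
with the coefficient of index 0, which does not depend on p and is killed by ∂_p^β. The orders
between form the momentum sum, with 1/(β₁! β₂!) rewritten as a binomial coefficient over j!. -/
lemma sum_eq_momentumSumS (n : ℕ) (F : ℕ × ℕ → ℕ → SmoothSymbol)
    (hF : ∀ β, MomentumFree (F β 0)) :
    ∑ u ∈ Finset.HasAntidiagonal.antidiagonal (n + 1), (1 / (2 * Complex.I) ^ u.1 : ℂ) •
      ∑ β ∈ Finset.HasAntidiagonal.antidiagonal u.1, (1 / (β.1 ! * β.2 ! : ℂ)) •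
        multiP β (F β u.2) =
      F (0, 0) (n + 1) + momentumSumS n fun j α => F α (n + 1 - j) := by
  rw [Finset.Nat.sum_antidiagonal_eq_sum_range_succ (fun l k => (1 / (2 * Complex.I) ^ l : ℂ) •
      ∑ β ∈ Finset.HasAntidiagonal.antidiagonal l, (1 / (β.1 ! * β.2 ! : ℂ)) •
        multiP β (F β k)), Finset.sum_range_succ, Nat.sub_self]
  have hlast : ∑ β ∈ Finset.HasAntidiagonal.antidiagonal (n + 1), (1 / (β.1 ! * β.2 ! : ℂ)) •
      multiP β (F β 0) = 0 := by
    refine Finset.sum_eq_zero fun β hβ => ?_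
    rw [(hF β).multiP_eq_zero, smul_zero]
    rintro rfl
    simp only [Finset.HasAntidiagonal.mem_antidiagonal] at hβ
    omega
  rw [hlast, smul_zero, add_zero, Finset.range_eq_Ico, Finset.sum_eq_sum_Ico_succ_bot (by omega)]
  congr 1
  · rw [show Finset.HasAntidiagonal.antidiagonal 0 = {((0, 0) : ℕ × ℕ)} from rfl]
    simp [multiP]
  · rw [momentumSumS, zero_add, Finset.Ico_add_one_right_eq_Icc]
    refine Finset.sum_congr rfl fun j _ => ?_
    rw [← one_div_mul_one_div, mul_smul, Finset.smul_sum (r := (1 / (j ! : ℂ)))]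
    congr 1
    refine Finset.sum_congr rfl fun β hβ => ?_
    rw [smul_smul]
    congr 1
    have h := Nat.add_choose_mul_factorial_mul_factorial β.2 β.1
    rw [add_comm, Finset.HasAntidiagonal.mem_antidiagonal.mp hβ] at h
    have h' : (j.choose β.1 : ℂ) * β.2 ! * β.1 ! = j ! := mod_cast h
    have hf : ∀ n : ℕ, ((n ! : ℕ) : ℂ) ≠ 0 := fun n => Nat.cast_ne_zero.mpr n.factorial_ne_zero
    have h₁ := hf β.1
    have h₂ := hf β.2
    have h₃ := hf j
    field_simp
    linear_combination -h'

/-! ### The rotating Pauli frame -/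

/-- The matrix with components `x, y, z, w` in the frame `σ_x, σ_y, σ_z, 1` at the angle with
cosine `c` and sine `s`. -/
def frame {A : Type*} [CommRing A] (c s x y z w : A) : Matrix (Fin 2) (Fin 2) A :=
  !![x * s + z * c + w, -(x * c) - y + z * s; -(x * c) + y + z * s, -(x * s) - z * c + w]

/-- These are the Pauli relations σ_zσ_x = σ_y, σ_x² = σ_z² = 1, with σ_y² = −1 in the real
normalization. The scalar components drop out. -/
lemma frame_commutator {A : Type*} [CommRing A] {c s : A} (h : c * c + s * s = 1)
    (b a e x y z w : A) :
    frame c s b 0 a e * frame c s x y z w - frame c s x y z w * frame c s b 0 a e =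
      frame c s (2 * (a * y)) (2 * (a * x - b * z)) (-(2 * (b * y))) 0 := by
  refine Matrix.ext fun i j => ?_
  rw [Matrix.sub_apply, Matrix.mul_apply, Matrix.mul_apply, Fin.sum_univ_two, Fin.sum_univ_two]
  fin_cases i <;> fin_cases j <;> simp [frame]
  · ring
  · linear_combination (-2 * (a * x - b * z)) * h
  · linear_combination (2 * (a * x - b * z)) * h
  · ring

lemma frame_anticommutator {A : Type*} [CommRing A] {c s : A} (h : c * c + s * s = 1)
    (b a e x y z w : A) :
    frame c s b 0 a e * frame c s x y z w + frame c s x y z w * frame c s b 0 a e =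
      frame c s (2 * (b * w + e * x)) (2 * (e * y)) (2 * (a * w + e * z))
        (2 * (a * z + b * x + e * w)) := by
  refine Matrix.ext fun i j => ?_
  rw [Matrix.add_apply, Matrix.mul_apply, Matrix.mul_apply, Fin.sum_univ_two, Fin.sum_univ_two]
  fin_cases i <;> fin_cases j <;> simp [frame]
  · linear_combination (2 * (a * z + b * x)) * h
  · ring
  · ring
  · linear_combination (2 * (a * z + b * x)) * h

/-- The component of a matrix along `σ_x`. -/
def compX (c s : SmoothSymbol) : SmoothMatrix →ₗ[ℂ] SmoothSymbol where
  toFun M := (1 / 2 : ℂ) • (s * (M 0 0 - M 1 1) - c * (M 0 1 + M 1 0))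
  map_add' M N := by rw [← smul_add]; congr 1; simp only [Matrix.add_apply]; ring
  map_smul' r M := by
    simp only [Matrix.smul_apply, ← smul_sub, ← smul_add, mul_smul_comm, RingHom.id_apply]
    rw [smul_comm]

/-- The component of a matrix along `σ_y`. -/
def compY : SmoothMatrix →ₗ[ℂ] SmoothSymbol where
  toFun M := (1 / 2 : ℂ) • (M 1 0 - M 0 1)
  map_add' M N := by rw [← smul_add]; congr 1; simp only [Matrix.add_apply]; ring
  map_smul' r M := by
    simp only [Matrix.smul_apply, ← smul_sub, RingHom.id_apply]
    rw [smul_comm]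

/-- The component of a matrix along `σ_z`. -/
def compZ (c s : SmoothSymbol) : SmoothMatrix →ₗ[ℂ] SmoothSymbol where
  toFun M := (1 / 2 : ℂ) • (c * (M 0 0 - M 1 1) + s * (M 0 1 + M 1 0))
  map_add' M N := by rw [← smul_add]; congr 1; simp only [Matrix.add_apply]; ring
  map_smul' r M := by
    simp only [Matrix.smul_apply, ← smul_sub, ← smul_add, mul_smul_comm, RingHom.id_apply]
    rw [smul_comm]

/-- The component of a matrix along `1`. -/
def compW : SmoothMatrix →ₗ[ℂ] SmoothSymbol where
  toFun M := (1 / 2 : ℂ) • (M 0 0 + M 1 1)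
  map_add' M N := by rw [← smul_add]; congr 1; simp only [Matrix.add_apply]; ring
  map_smul' r M := by
    simp only [Matrix.smul_apply, ← smul_add, RingHom.id_apply]
    rw [smul_comm]

lemma half_smul_eq {a b : SmoothSymbol} (h : a = b + b) : (1 / 2 : ℂ) • a = b := by
  rw [h]
  module

section Components

variable {c s : SmoothSymbol} (hcs : c * c + s * s = 1) (x y z w : SmoothSymbol)

include hcs in
lemma compX_frame : compX c s (frame c s x y z w) = x := by
  apply half_smul_eq
  simp only [frame, Matrix.of_apply, Matrix.cons_val', Matrix.cons_val_zero, Matrix.cons_val_one,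
    Matrix.cons_val_fin_one]
  linear_combination (2 * x) * hcs

lemma compY_frame : compY (frame c s x y z w) = y := by
  apply half_smul_eq
  simp only [frame, Matrix.of_apply, Matrix.cons_val', Matrix.cons_val_zero, Matrix.cons_val_one,
    Matrix.cons_val_fin_one]
  ring

include hcs in
lemma compZ_frame : compZ c s (frame c s x y z w) = z := by
  apply half_smul_eq
  simp only [frame, Matrix.of_apply, Matrix.cons_val', Matrix.cons_val_zero, Matrix.cons_val_one,
    Matrix.cons_val_fin_one]
  linear_combination (2 * z) * hcs

lemma compW_frame : compW (frame c s x y z w) = w := by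
  apply half_smul_eq
  simp only [frame, Matrix.of_apply, Matrix.cons_val', Matrix.cons_val_zero, Matrix.cons_val_one,
    Matrix.cons_val_fin_one]
  ring

include hcs in
lemma frame_comp (M : SmoothMatrix) :
    frame c s (compX c s M) (compY M) (compZ c s M) (compW M) = M := by
  have h : ∀ a : SmoothSymbol, (1 / 2 : ℂ) • a + (1 / 2 : ℂ) • a = a := fun a => by module
  -- Comparing doubled entries removes the factors 1/2 in the components and leaves polynomial
  -- identities modulo c² + s² = 1.
  have e : ∀ a b : SmoothSymbol, a + a = b + b → a = b := fun a b hab => by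
    rw [← h a, ← h b, ← smul_add, ← smul_add, hab]
  obtain ⟨hX, hY, hZ, hW⟩ : (compX c s M + compX c s M = s * (M 0 0 - M 1 1) - c * (M 0 1 + M 1 0)) ∧
    (compY M + compY M = M 1 0 - M 0 1) ∧
    (compZ c s M + compZ c s M = c * (M 0 0 - M 1 1) + s * (M 0 1 + M 1 0)) ∧
    (compW M + compW M = M 0 0 + M 1 1) := ⟨h _, h _, h _, h _⟩
  refine Matrix.ext fun i j => e _ _ ?_
  fin_cases i <;> fin_cases j <;> simp [frame]
  · linear_combination s * hX + c * hZ + hW + (M 0 0 - M 1 1) * hcs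
  · linear_combination -c * hX - hY + s * hZ + (M 0 1 + M 1 0) * hcs
  · linear_combination -c * hX + hY + s * hZ + (M 0 1 + M 1 0) * hcs
  · linear_combination -s * hX - c * hZ + hW - (M 0 0 - M 1 1) * hcs

end Components

/-- The component `a_α` of `∂_q^α (ρ σ_z)` along `σ_z`. -/
def coeffA (c s ρ : SmoothSymbol) (α : ℕ × ℕ) : SmoothSymbol :=
  c * multiQ α (ρ * c) + s * multiQ α (ρ * s)

/-- The component `b_α` of `∂_q^α (ρ σ_z)` along `σ_x`. -/
def coeffB (c s ρ : SmoothSymbol) (α : ℕ × ℕ) : SmoothSymbol :=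
  s * multiQ α (ρ * c) - c * multiQ α (ρ * s)

/-- Derivatives of ρσ_z stay real-linear combinations of the same two symmetric traceless shapes, so
no σ_y component appears, and the trace part is differentiated separately. -/
lemma map_multiQ_potential {c s : SmoothSymbol} (hcs : c * c + s * s = 1) (ρ d : SmoothSymbol)
    (α : ℕ × ℕ) : (frame c s 0 0 ρ d).map (multiQ α) =
      frame c s (coeffB c s ρ α) 0 (coeffA c s ρ α) (multiQ α d) := by
  refine Matrix.ext fun i j => ?_
  rw [Matrix.map_apply]
  fin_cases i <;> fin_cases j <;> simp [frame, coeffA, coeffB]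
  · linear_combination -multiQ α (ρ * c) * hcs
  · linear_combination -multiQ α (ρ * s) * hcs
  · linear_combination -multiQ α (ρ * s) * hcs
  · linear_combination multiQ α (ρ * c) * hcs

lemma map_multiP_frame {c s : SmoothSymbol} (hc : MomentumFree c) (hs : MomentumFree s)
    (x y z w : SmoothSymbol) (α : ℕ × ℕ) : (frame c s x y z w).map (multiP α) =
      frame c s (multiP α x) (multiP α y) (multiP α z) (multiP α w) := by
  refine Matrix.ext fun i j => ?_
  rw [Matrix.map_apply]
  fin_cases i <;> fin_cases j <;>
    simp [frame, mul_comm _ c, mul_comm _ s, hc.multiP_mul, hs.multiP_mul]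

/-- With t = p·∇θ the frame rotates along the flow: σ_z is carried to −tσ_x and σ_x to tσ_z, which
yields the connection terms in the x and z components. -/
lemma map_transportS_frame {c s t : SmoothSymbol} (hc : transportS c = -(s * t))
    (hs : transportS s = c * t) (x y z w : SmoothSymbol) :
    (frame c s x y z w).map transportS =
      frame c s (transportS x - z * t) (transportS y) (transportS z + x * t) (transportS w) := by
  refine Matrix.ext fun i j => ?_
  rw [Matrix.map_apply]
  fin_cases i <;> fin_cases j <;>
    simp [frame, transportS_add, transportS_sub, transportS_neg, transportS_mul, hc, hs] <;> ring

/-! ### Recursions for the components -/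

open FormalMatrix in
/-- The order `n + 1` of `[H, π] = 0`, seen through a linear map `comp`. -/
lemma component_recursion {W : SmoothMatrix} (hW : ∀ i j, MomentumFree (W i j)) {P : FormalMatrix}
    (hcomm : const (kineticEnergy • 1 + W) * P = P * const (kineticEnergy • 1 + W)) (n : ℕ)
    (comp : SmoothMatrix →ₗ[ℂ] SmoothSymbol) (F : ℕ × ℕ → ℕ → SmoothSymbol)
    (hF : ∀ β, MomentumFree (F β 0))
    (hL : ∀ l k β, l + k = n + 1 → comp ((-1 : ℂ) ^ l •
      (W.map (multiQ β) * (coeffM k P).map (multiP β)) -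
        (coeffM k P).map (multiP β) * W.map (multiQ β)) = (-2 : ℂ) • multiP β (F β k)) :
    (1 / Complex.I) • comp ((coeffM n P).map transportS) =
      (2 : ℂ) • (F (0, 0) (n + 1) + momentumSumS n fun j α => F α (n + 1 - j)) := by
  have h := congrArg comp (coeffM_commutator W hW P n)
  rw [hcomm, sub_self, map_zero, map_zero, map_add, map_smul, map_sum] at h
  have h' : ∑ u ∈ Finset.HasAntidiagonal.antidiagonal (n + 1),
      comp ((1 / (2 * Complex.I) ^ u.1 : ℂ) •
        ∑ β ∈ Finset.HasAntidiagonal.antidiagonal u.1, (1 / (β.1 ! * β.2 ! : ℂ)) •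
          ((-1 : ℂ) ^ u.1 • (W.map (multiQ β) * (coeffM u.2 P).map (multiP β)) -
            (coeffM u.2 P).map (multiP β) * W.map (multiQ β))) =
      (-2 : ℂ) • ∑ u ∈ Finset.HasAntidiagonal.antidiagonal (n + 1),
        (1 / (2 * Complex.I) ^ u.1 : ℂ) • ∑ β ∈ Finset.HasAntidiagonal.antidiagonal u.1,
          (1 / (β.1 ! * β.2 ! : ℂ)) • multiP β (F β u.2) := by
    rw [Finset.smul_sum]
    refine Finset.sum_congr rfl fun u hu => ?_
    rw [map_smul, map_sum, smul_comm (-2 : ℂ) (1 / (2 * Complex.I) ^ u.1 : ℂ)]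
    congr 1
    rw [Finset.smul_sum]
    refine Finset.sum_congr rfl fun β _ => ?_
    rw [map_smul, hL _ _ _ (Finset.HasAntidiagonal.mem_antidiagonal.mp hu), smul_comm]
  rw [h', sum_eq_momentumSumS n F hF] at h
  rw [neg_smul, ← sub_eq_add_neg] at h
  exact sub_eq_zero.mp h.symm

section Recursions

open FormalMatrix

variable {c s t ρ d : SmoothSymbol} (hc : MomentumFree c) (hs : MomentumFree s)
  (hρ : MomentumFree ρ) (hd : MomentumFree d) (hcs : c * c + s * s = 1)
  (htc : transportS c = -(s * t)) (hts : transportS s = c * t) {P : FormalMatrix}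
  {x y z w : ℕ → SmoothSymbol} (hP : ∀ k, coeffM k P = frame c s (x k) (y k) (z k) (w k))
  (hcomm : const (kineticEnergy • 1 + frame c s 0 0 ρ d) * P =
    P * const (kineticEnergy • 1 + frame c s 0 0 ρ d))
  (hx₀ : MomentumFree (x 0)) (hz₀ : MomentumFree (z 0)) (hw₀ : MomentumFree (w 0))
  (hodd : ∀ k, Odd k → x k = 0 ∧ z k = 0 ∧ w k = 0) (heven : ∀ k, Even k → y k = 0)

include hc hs hρ in
lemma momentumFree_coeffA (α : ℕ × ℕ) : MomentumFree (coeffA c s ρ α) :=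
  (hc.mul ((hρ.mul hc).multiQ α)).add (hs.mul ((hρ.mul hs).multiQ α))

include hc hs hρ in
lemma momentumFree_coeffB (α : ℕ × ℕ) : MomentumFree (coeffB c s ρ α) :=
  (hs.mul ((hρ.mul hc).multiQ α)).sub (hc.mul ((hρ.mul hs).multiQ α))

include hcs in
lemma coeffA_zero : coeffA c s ρ (0, 0) = ρ := by
  simp [coeffA, multiQ]
  linear_combination ρ * hcs

lemma coeffB_zero : coeffB c s ρ (0, 0) = 0 := by
  simp [coeffB, multiQ]
  ring

include hc hs hρ hd in
lemma momentumFree_potential (i j : Fin 2) : MomentumFree (frame c s 0 0 ρ d i j) := by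
  fin_cases i <;> fin_cases j <;> simp [frame]
  · exact (hρ.mul hc).add hd
  · exact hρ.mul hs
  · exact hρ.mul hs
  · exact (hρ.mul hc).neg.add hd

include hc hs hcs hP in
-- The sign (−1)^l decides whether the Moyal order l contributes a commutator or minus an
-- anticommutator of differentiated matrices.
lemma signed_commutator (l k : ℕ) (β : ℕ × ℕ) : (-1 : ℂ) ^ l •
      ((frame c s 0 0 ρ d).map (multiQ β) * (coeffM k P).map (multiP β)) -
        (coeffM k P).map (multiP β) * (frame c s 0 0 ρ d).map (multiQ β) =
    if Even l then
      frame c s (2 * (coeffA c s ρ β * multiP β (y k)))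
        (2 * (coeffA c s ρ β * multiP β (x k) - coeffB c s ρ β * multiP β (z k)))
        (-(2 * (coeffB c s ρ β * multiP β (y k)))) 0
    else
      -frame c s (2 * (coeffB c s ρ β * multiP β (w k) + multiQ β d * multiP β (x k)))
        (2 * (multiQ β d * multiP β (y k)))
        (2 * (coeffA c s ρ β * multiP β (w k) + multiQ β d * multiP β (z k)))
        (2 * (coeffA c s ρ β * multiP β (z k) + coeffB c s ρ β * multiP β (x k) +
          multiQ β d * multiP β (w k))) := by
  rw [hP, map_multiQ_potential hcs, map_multiP_frame hc hs]
  split_ifs with h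
  · rw [h.neg_one_pow, one_smul, frame_commutator hcs]
  · rw [(Nat.not_even_iff_odd.mp h).neg_one_pow, ← frame_anticommutator hcs]
    module

include hc hs hρ hd hcs htc hts hP hcomm hx₀ hz₀ hodd heven in
-- This is the σ_y component. Since l + k = n + 1 is even, l and k have the same parity: even l
-- gives the commutator part in x and z, where y_k = 0, and odd l the term with d, where x_k = z_k =
-- 0. One formula thus covers both cases, and the l = 0 term gives x_{n+1}.
lemma recursion_y {n : ℕ} (hn : Odd n) :
    (1 / Complex.I) • transportS (y n) = (2 : ℂ) • (-(ρ * x (n + 1)) +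
      momentumSumS n fun j α => coeffB c s ρ α * z (n + 1 - j) - coeffA c s ρ α * x (n + 1 - j) +
        multiQ α d * y (n + 1 - j)) := by
  have hA := momentumFree_coeffA hc hs hρ
  have hB := momentumFree_coeffB hc hs hρ
  have h := component_recursion (momentumFree_potential hc hs hρ hd) hcomm n compY
    (fun α k => coeffB c s ρ α * z k - coeffA c s ρ α * x k + multiQ α d * y k)
    (fun α => (((hB α).mul hz₀).sub ((hA α).mul hx₀)).add ((hd.multiQ α).mul (by
      rw [heven 0 (by simp)]; exact .zero)))
    (fun l k β hlk => by
      rw [signed_commutator hc hs hcs hP]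
      simp only [map_add, map_sub, (hA β).multiP_mul, (hB β).multiP_mul, (hd.multiQ β).multiP_mul]
      split_ifs with hl
      · rw [compY_frame, heven k (by grind)]
        simp only [map_zero, mul_zero, add_zero, neg_smul, two_smul]
        ring
      · rw [map_neg, compY_frame, (hodd k (by grind)).1, (hodd k (by grind)).2.1]
        simp only [map_zero, mul_zero, neg_smul, two_smul]
        ring)
  rw [hP, map_transportS_frame htc hts, compY_frame, coeffA_zero hcs, coeffB_zero,
    heven (n + 1) hn.add_one] at h
  simpa using h

include hc hs hρ hd hcs htc hts hP hcomm hx₀ hw₀ hodd heven in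
-- This is the σ_x component. Now l and k have opposite parity: even l pairs with y_k, odd l with
-- w_k and x_k. As b_0 = 0 and x_{n+1} = 0, only y_{n+1} survives at l = 0.
lemma recursion_x {n : ℕ} (hn : Even n) :
    (1 / Complex.I) • (transportS (x n) - z n * t) = (2 : ℂ) • (-(ρ * y (n + 1)) +
      momentumSumS n fun j α => -(coeffA c s ρ α * y (n + 1 - j)) +
        coeffB c s ρ α * w (n + 1 - j) + multiQ α d * x (n + 1 - j)) := by
  have hA := momentumFree_coeffA hc hs hρ
  have hB := momentumFree_coeffB hc hs hρ
  have h := component_recursion (momentumFree_potential hc hs hρ hd) hcomm n (compX c s)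
    (fun α k => -(coeffA c s ρ α * y k) + coeffB c s ρ α * w k + multiQ α d * x k)
    (fun α => (((hA α).mul (by rw [heven 0 (by simp)]; exact .zero)).neg.add
      ((hB α).mul hw₀)).add ((hd.multiQ α).mul hx₀))
    (fun l k β hlk => by
      rw [signed_commutator hc hs hcs hP]
      simp only [map_add, map_neg, (hA β).multiP_mul, (hB β).multiP_mul,
        (hd.multiQ β).multiP_mul]
      split_ifs with hl
      · rw [compX_frame hcs, (hodd k (by grind)).1, (hodd k (by grind)).2.2]
        simp only [map_zero, mul_zero, add_zero, neg_smul, two_smul]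
        ring
      · rw [map_neg, compX_frame hcs, heven k (by grind)]
        simp only [map_zero, mul_zero, neg_smul, two_smul]
        ring)
  rw [hP, map_transportS_frame htc hts, compX_frame hcs, coeffA_zero hcs, coeffB_zero,
    (hodd (n + 1) hn.add_one).1] at h
  simpa using h

include hc hs hρ hd hcs htc hts hP hcomm hz₀ hw₀ hodd heven in
-- In the σ_z component nothing of order n + 1 survives: b_0 = 0, and w and z vanish at odd order.
-- The equation is therefore a transport constraint on z_n instead of a formula for a new
-- coefficient.
lemma recursion_z {n : ℕ} (hn : Even n) :
    (1 / Complex.I) • (transportS (z n) + x n * t) = (2 : ℂ) • momentumSumS n fun j α =>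
      coeffB c s ρ α * y (n + 1 - j) + coeffA c s ρ α * w (n + 1 - j) +
        multiQ α d * z (n + 1 - j) := by
  have hA := momentumFree_coeffA hc hs hρ
  have hB := momentumFree_coeffB hc hs hρ
  have h := component_recursion (momentumFree_potential hc hs hρ hd) hcomm n (compZ c s)
    (fun α k => coeffB c s ρ α * y k + coeffA c s ρ α * w k + multiQ α d * z k)
    (fun α => (((hB α).mul (by rw [heven 0 (by simp)]; exact .zero)).add
      ((hA α).mul hw₀)).add ((hd.multiQ α).mul hz₀))
    (fun l k β hlk => by
      rw [signed_commutator hc hs hcs hP]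
      simp only [map_add, (hA β).multiP_mul, (hB β).multiP_mul, (hd.multiQ β).multiP_mul]
      split_ifs with hl
      · rw [compZ_frame hcs, (hodd k (by grind)).2.1, (hodd k (by grind)).2.2]
        simp only [map_zero, mul_zero, add_zero, neg_smul, two_smul]
        ring
      · rw [map_neg, compZ_frame hcs, heven k (by grind)]
        simp only [map_zero, mul_zero, neg_smul, two_smul]
        ring)
  rw [hP, map_transportS_frame htc hts, compZ_frame hcs, coeffB_zero,
    (hodd (n + 1) hn.add_one).2.1, (hodd (n + 1) hn.add_one).2.2] at h
  simpa using h

include hc hs hρ hd hcs htc hts hP hcomm hx₀ hz₀ hw₀ hodd in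
-- Commutators are traceless, so even l contributes nothing to the trace; the summands for even l
-- vanish as well, because k is then odd.
lemma recursion_w {n : ℕ} (hn : Even n) :
    (1 / Complex.I) • transportS (w n) = (2 : ℂ) • momentumSumS n fun j α =>
      coeffA c s ρ α * z (n + 1 - j) + coeffB c s ρ α * x (n + 1 - j) +
        multiQ α d * w (n + 1 - j) := by
  have hA := momentumFree_coeffA hc hs hρ
  have hB := momentumFree_coeffB hc hs hρ
  have h := component_recursion (momentumFree_potential hc hs hρ hd) hcomm n compW
    (fun α k => coeffA c s ρ α * z k + coeffB c s ρ α * x k + multiQ α d * w k)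
    (fun α => (((hA α).mul hz₀).add ((hB α).mul hx₀)).add ((hd.multiQ α).mul hw₀))
    (fun l k β hlk => by
      rw [signed_commutator hc hs hcs hP]
      simp only [map_add, (hA β).multiP_mul, (hB β).multiP_mul, (hd.multiQ β).multiP_mul]
      split_ifs with hl
      · rw [compW_frame, (hodd k (by grind)).1, (hodd k (by grind)).2.1, (hodd k (by grind)).2.2]
        simp
      · rw [map_neg, compW_frame]
        simp only [neg_smul, two_smul]
        ring)
  rw [hP, map_transportS_frame htc hts, compW_frame, (hodd (n + 1) hn.add_one).1,
    (hodd (n + 1) hn.add_one).2.1, (hodd (n + 1) hn.add_one).2.2] at h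
  simpa using h

end Recursions

/-! ### The two-level system as algebraic data -/

open FormalMatrix

section Rotation

variable {A : Type*} [CommRing A]

/-- The rotation with cosine `c` and sine `s`. -/
def planeRotation (c s : A) : Matrix (Fin 2) (Fin 2) A := !![c, s; -s, c]

lemma planeRotation_mul_rotation_neg {c s : A} (h : c * c + s * s = 1) :
    planeRotation c s * planeRotation c (-s) = 1 := by
  refine Matrix.ext fun i j => ?_
  rw [Matrix.mul_apply, Fin.sum_univ_two]
  fin_cases i <;> fin_cases j <;> simp [planeRotation]
  · linear_combination h
  · ring
  · ring
  · linear_combination h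

/-- Rotation by half the angle turns the frame `σ_x, σ_y, σ_z` into the standard one. -/
lemma planeRotation_conj_frame {c s : A} (h : c * c + s * s = 1) (x y z w : A) :
    planeRotation c s * frame (c * c - s * s) (2 * (c * s)) x y z w * planeRotation c (-s) =
      frame 1 0 x y z w := by
  -- The intertwining relation needs the half-angle identity only once per entry; the inverse
  -- rotation is multiplied on afterwards.
  have h₁ : planeRotation c s * frame (c * c - s * s) (2 * (c * s)) x y z w =
      frame 1 0 x y z w * planeRotation c s := by
    refine Matrix.ext fun i j => ?_
    rw [Matrix.mul_apply, Matrix.mul_apply, Fin.sum_univ_two, Fin.sum_univ_two]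
    fin_cases i <;> fin_cases j <;> simp [planeRotation, frame]
    · linear_combination (x * s + z * c) * h
    · linear_combination (-(x * c) + z * s) * h
    · linear_combination (-(x * c) + z * s) * h
    · linear_combination (-(x * s) - z * c) * h
  rw [h₁, mul_assoc, planeRotation_mul_rotation_neg h, mul_one]

lemma frame_half_mul_self {c s h : A} (hcs : c * c + s * s = 1) (hh : h + h = 1) :
    frame c s 0 0 h h * frame c s 0 0 h h = frame c s 0 0 h h := by
  refine Matrix.ext fun i j => ?_
  rw [Matrix.mul_apply, Fin.sum_univ_two]
  fin_cases i <;> fin_cases j <;> simp [frame]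
  · linear_combination h * h * hcs + h * (1 + c) * hh
  · linear_combination h * s * hh
  · linear_combination h * s * hh
  · linear_combination h * h * hcs + h * (1 - c) * hh

end Rotation

/-- The data of the two-level Hamiltonian as smooth symbols: `c`, `s` are the cosine and sine of the
half angle, `ρ` half the gap with `2 ρ g = 1`, and `d` the trace part. -/
structure TwoLevelData where
  c : SmoothSymbol
  s : SmoothSymbol
  ρ : SmoothSymbol
  g : SmoothSymbol
  d : SmoothSymbol
  star_c : star c = c
  star_s : star s = s
  star_ρ : star ρ = ρ
  star_g : star g = g
  star_d : star d = d
  sq_add_sq : c * c + s * s = 1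
  gap : g * (2 * ρ) = 1

namespace TwoLevelData

variable (D : TwoLevelData)

/-- The cosine of the angle. -/
def cosine : SmoothSymbol := D.c * D.c - D.s * D.s

/-- The sine of the angle. -/
def sine : SmoothSymbol := 2 * (D.c * D.s)

/-- The constant symbol `1 / 2`. -/
def half : SmoothSymbol := (1 / 2 : ℂ) • 1

/-- The symbol of the Hamiltonian. -/
def hamiltonianM : SmoothMatrix := kineticEnergy • 1 + frame D.cosine D.sine 0 0 D.ρ D.d

/-- The principal symbol of the projection. -/
def principal : SmoothMatrix := frame D.cosine D.sine 0 0 half half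

/-- The adiabatic frame. -/
def frameR : SmoothMatrix := planeRotation D.c D.s

lemma cosine_sq_add_sine_sq : D.cosine * D.cosine + D.sine * D.sine = 1 := by
  have h := D.sq_add_sq
  simp only [cosine, sine]
  linear_combination (D.c * D.c + D.s * D.s + 1) * h

lemma half_add_half : half + half = 1 := by
  simp only [half]
  module

lemma star_half : star half = half := by
  simp [half, star_smul_smooth]

lemma star_cosine : star D.cosine = D.cosine := by
  simp [cosine, D.star_c, D.star_s]

lemma star_sine : star D.sine = D.sine := by
  simp [sine, D.star_c, D.star_s, mul_comm]

lemma star_frameR : star D.frameR = planeRotation D.c (-D.s) := by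
  refine Matrix.ext fun i j => ?_
  rw [Matrix.star_apply]
  fin_cases i <;> fin_cases j <;> simp [frameR, planeRotation, D.star_c, D.star_s]

lemma frameR_mul_star : D.frameR * star D.frameR = 1 := by
  rw [star_frameR]
  exact planeRotation_mul_rotation_neg D.sq_add_sq

lemma star_mul_frameR : star D.frameR * D.frameR = 1 :=
  mul_eq_one_comm.mp D.frameR_mul_star

lemma frameR_conj (x y z w : SmoothSymbol) :
    D.frameR * frame D.cosine D.sine x y z w * star D.frameR = frame 1 0 x y z w := by
  rw [star_frameR]
  exact planeRotation_conj_frame D.sq_add_sq x y z w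

lemma frameR_conj_principal :
    D.frameR * D.principal * star D.frameR = firstProj SmoothSymbol := by
  rw [principal, frameR_conj]
  refine Matrix.ext fun i j => ?_
  fin_cases i <;> fin_cases j <;> simp [frame, firstProj, half_add_half]

/-- The diagonal form of the Hamiltonian. -/
def diagonal : SmoothMatrix :=
  !![kineticEnergy + D.d + D.ρ, 0; 0, kineticEnergy + D.d - D.ρ]

lemma frameR_conj_hamiltonianM : D.frameR * D.hamiltonianM * star D.frameR = D.diagonal := by
  rw [hamiltonianM, mul_add, add_mul, frameR_conj, mul_smul_comm, mul_one, smul_mul_assoc,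
    frameR_mul_star]
  refine Matrix.ext fun i j => ?_
  fin_cases i <;> fin_cases j <;> simp [frame, diagonal] <;> ring

lemma gap_diagonal : D.g * (D.diagonal 0 0 - D.diagonal 1 1) = 1 := by
  simp only [diagonal, Matrix.of_apply, Matrix.cons_val', Matrix.cons_val_zero,
    Matrix.cons_val_one, Matrix.cons_val_fin_one]
  linear_combination D.gap

lemma star_hamiltonianM : star D.hamiltonianM = D.hamiltonianM := by
  refine Matrix.ext fun i j => ?_
  rw [Matrix.star_apply]
  fin_cases i <;> fin_cases j <;>
    simp [hamiltonianM, frame, star_kineticEnergy, D.star_ρ, D.star_d, star_cosine, star_sine]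

lemma transpose_hamiltonianM : D.hamiltonianMᵀ = D.hamiltonianM := by
  refine Matrix.ext fun i j => ?_
  rw [Matrix.transpose_apply]
  fin_cases i <;> fin_cases j <;> simp [hamiltonianM, frame]

lemma star_principal : star D.principal = D.principal := by
  refine Matrix.ext fun i j => ?_
  rw [Matrix.star_apply]
  fin_cases i <;> fin_cases j <;>
    simp [principal, frame, star_half, star_cosine, star_sine]

lemma transpose_principal : D.principalᵀ = D.principal := by
  refine Matrix.ext fun i j => ?_
  rw [Matrix.transpose_apply]
  fin_cases i <;> fin_cases j <;> simp [principal, frame]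

lemma principal_mul_self : D.principal * D.principal = D.principal :=
  frame_half_mul_self D.cosine_sq_add_sine_sq half_add_half

/-- With two eigenvalues, the spectral projection of the upper one is (H_0 − lower eigenvalue)/gap.
Being affine in H_0, it commutes with whatever commutes with H_0, as uniqueness requires. -/
lemma principal_eq : D.principal = D.g • (D.hamiltonianM - (kineticEnergy + D.d - D.ρ) • 1) := by
  have h := D.gap
  have hh : half = D.g * D.ρ := by
    have e : half + half = D.g * D.ρ + D.g * D.ρ := by
      rw [half_add_half, ← h]
      ring
    have k : ∀ a : SmoothSymbol, (1 / 2 : ℂ) • (a + a) = a := fun a => by module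
    rw [← k half, e, k]
  refine Matrix.ext fun i j => ?_
  fin_cases i <;> fin_cases j <;> simp [principal, hamiltonianM, frame, hh] <;> ring

lemma commutes_principal (X : SmoothMatrix)
    (h : coeffM 0 (const D.hamiltonianM) * X = X * coeffM 0 (const D.hamiltonianM)) :
    D.principal * X = X * D.principal := by
  change D.hamiltonianM * X = X * D.hamiltonianM at h
  rw [principal_eq, smul_mul_assoc, mul_smul_comm, sub_mul, mul_sub, h, smul_mul_assoc,
    mul_smul_comm, one_mul, mul_one]

lemma star_const_hamiltonianM : star (const D.hamiltonianM) = const D.hamiltonianM := by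
  rw [star_const, star_hamiltonianM]

lemma exists_isProjection : ∃ P, IsProjection (const D.hamiltonianM) D.principal P :=
  FormalMatrix.exists_isProjection D.star_const_hamiltonianM D.frameR_mul_star D.star_mul_frameR
    D.frameR_conj_principal D.frameR_conj_hamiltonianM rfl rfl D.star_g D.gap_diagonal
    D.principal_mul_self D.commutes_principal

variable {D} {P : FormalMatrix} (hP : IsProjection (const D.hamiltonianM) D.principal P)

include hP

lemma isProjection_unique {P' : FormalMatrix}
    (hP' : IsProjection (const D.hamiltonianM) D.principal P') : P' = P :=
  hP'.unique D.principal_mul_self D.commutes_principal hP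

/-- The adjoint solves the same defining equations because H and the principal symbol are
self-adjoint, so uniqueness applies. -/
lemma star_projection : star P = P := by
  refine isProjection_unique hP ⟨?_, ?_, ?_⟩
  · rw [coeffM_star, hP.principal, star_principal]
  · rw [← star_mul, hP.idempotent]
  · have h := congrArg star hP.commutes
    rw [star_mul, star_mul, star_const_hamiltonianM] at h
    exact h.symm

/-- Transposition with ε ↦ −ε reverses products and fixes the real symmetric H and principal symbol,
so by uniqueness it fixes the projection. All parity statements come from here. -/
lemma flipTranspose_projection : flipTranspose P = P := by
  refine isProjection_unique hP ⟨?_, ?_, ?_⟩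
  · rw [coeffM_flipTranspose, hP.principal, transpose_principal, pow_zero, one_smul]
  · rw [← flipTranspose_mul, hP.idempotent]
  · have h := congrArg flipTranspose hP.commutes
    rw [flipTranspose_mul, flipTranspose_mul, flipTranspose_const, transpose_hamiltonianM] at h
    exact h.symm

lemma coeffM_projection_even {k : ℕ} (hk : Even k) : (coeffM k P)ᵀ = coeffM k P := by
  have h := congrArg (coeffM k) (flipTranspose_projection hP)
  rwa [coeffM_flipTranspose, hk.neg_one_pow, one_smul] at h

lemma coeffM_projection_odd {k : ℕ} (hk : Odd k) : (coeffM k P)ᵀ = -coeffM k P := by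
  have h := congrArg (coeffM k) (flipTranspose_projection hP)
  rw [coeffM_flipTranspose, hk.neg_one_pow, neg_one_smul] at h
  exact (neg_eq_iff_eq_neg.mp h)

lemma compY_projection_even {k : ℕ} (hk : Even k) : compY (coeffM k P) = 0 := by
  have h := congrFun (congrFun (coeffM_projection_even hP hk) 0) 1
  apply half_smul_eq
  rw [← h, Matrix.transpose_apply]
  ring

lemma comp_projection_odd {k : ℕ} (hk : Odd k) :
    compX D.cosine D.sine (coeffM k P) = 0 ∧ compZ D.cosine D.sine (coeffM k P) = 0 ∧
      compW (coeffM k P) = 0 := by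
  have h := coeffM_projection_odd hP hk
  have h₀₁ : coeffM k P 1 0 = -coeffM k P 0 1 := congrFun (congrFun h 0) 1
  have e : ∀ a : SmoothSymbol, a = -a → a = 0 := fun a ha => by
    have : a = (1 / 2 : ℂ) • (a - -a) := by module
    rw [this, ← ha, sub_self, smul_zero]
  have h₀ : coeffM k P 0 0 = 0 := e _ (congrFun (congrFun h 0) 0)
  have h₁ : coeffM k P 1 1 = 0 := e _ (congrFun (congrFun h 1) 1)
  refine ⟨half_smul_eq ?_, half_smul_eq ?_, half_smul_eq ?_⟩ <;> rw [h₀, h₁] <;>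
    simp [h₀₁]

/-- Superadiabatic representations exist to every order. -/
lemma exists_superadiabatic (n : ℕ) : ∃ U : FormalMatrix, coeffM 0 U = D.frameR ∧
    VanishesBelow (n + 2) (U * star U - 1) ∧ DiagonalBelow (n + 2) (U * trunc n P * star U) := by
  have h₀ : coeffM 0 (trunc n P) = D.principal := by
    rw [coeffM_trunc, if_pos (Nat.zero_le n), hP.principal]
  -- The diagonalized series is now the truncated projection, whose leading term becomes diag(1,0)
  -- with gap 1. Taking n + 1 steps gives errors of order n + 2.
  exact exists_diagonalizing_unitary (g := 1) (by rw [star_trunc, star_projection hP])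
    D.frameR_mul_star (by rw [h₀, frameR_conj_principal]) rfl rfl (star_one _)
    (by simp [firstProj]) (n + 1)

/-- The off-diagonal coupling in the `n`-th superadiabatic representation. -/
lemma superadiabatic_coupling {n : ℕ} {U : FormalMatrix} (hU₀ : coeffM 0 U = D.frameR)
    (hU : VanishesBelow (n + 2) (star U * U - 1))
    (hUP : DiagonalBelow (n + 2) (U * trunc n P * star U)) :
    DiagonalBelow (n + 1) (U * const D.hamiltonianM * star U) ∧
    coeffM (n + 1) (U * const D.hamiltonianM * star U) 0 1 = (-2 : ℂ) •
      (D.ρ * (compX D.cosine D.sine (coeffM (n + 1) P) + compY (coeffM (n + 1) P))) ∧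
    coeffM (n + 1) (U * const D.hamiltonianM * star U) 1 0 = (-2 : ℂ) •
      (D.ρ * (compX D.cosine D.sine (coeffM (n + 1) P) - compY (coeffM (n + 1) P))) := by
  set x := compX D.cosine D.sine (coeffM (n + 1) P) with hx
  set y := compY (coeffM (n + 1) P) with hy
  have hδ : coeffM (n + 1) (P - trunc n P) = coeffM (n + 1) P := by
    rw [map_sub, coeffM_trunc, if_neg (by omega), sub_zero]
  -- The first omitted term is π_{n+1}. In its commutator with H_0 the scalar part cancels and ρσ_z
  -- turns (x, y) into (2ρy, 2ρx); the rotation R then makes the frame standard, so the off-diagonal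
  -- entries are sums and differences of x and y.
  have hC : coeffM 0 U * (coeffM 0 (const D.hamiltonianM) * coeffM (n + 1) (P - trunc n P) -
      coeffM (n + 1) (P - trunc n P) * coeffM 0 (const D.hamiltonianM)) * star (coeffM 0 U) =
      frame 1 0 (2 * (D.ρ * y)) (2 * (D.ρ * x)) 0 0 := by
    rw [hδ, hU₀, coeffM_const, if_pos rfl, hamiltonianM, add_mul, mul_add, smul_mul_assoc,
      mul_smul_comm, one_mul, mul_one, add_sub_add_left_eq_sub,
      ← frame_comp D.cosine_sq_add_sine_sq (coeffM (n + 1) P),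
      frame_commutator D.cosine_sq_add_sine_sq, frameR_conj]
    simp [hx, hy]
  have hUT₀ : coeffM 0 (U * trunc n P * star U) = firstProj SmoothSymbol := by
    rw [coeffM_zero_mul, coeffM_zero_mul, coeffM_star, hU₀, coeffM_trunc,
      if_pos (Nat.zero_le n), hP.principal, frameR_conj_principal]
  obtain ⟨h₁, h₂, h₃⟩ := offDiagonal_conj (n := n + 1) hP.commutes (vanishesBelow_sub_trunc n P) hU
    hUP hUT₀ hC
  refine ⟨h₁, h₂.trans ?_, h₃.trans ?_⟩
  · simp only [frame, Matrix.of_apply, Matrix.cons_val', Matrix.cons_val_zero,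
      Matrix.cons_val_one, Matrix.cons_val_fin_one, neg_smul, two_smul]
    ring
  · simp only [frame, Matrix.of_apply, Matrix.cons_val', Matrix.cons_val_zero,
      Matrix.cons_val_one, Matrix.cons_val_fin_one, neg_smul, two_smul]
    ring

end TwoLevelData

/-! ### The real coefficient functions a_α and b_α -/

lemma posDeriv_add (i : Fin 2) {f g : Plane → ℝ} (hf : ContDiff ℝ ∞ f) (hg : ContDiff ℝ ∞ g) :
    posDeriv i (f + g) = posDeriv i f + posDeriv i g := by
  funext q
  simp [posDeriv, fderiv_add (hf.differentiable (by simp) q) (hg.differentiable (by simp) q)]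

lemma posDeriv_sub (i : Fin 2) {f g : Plane → ℝ} (hf : ContDiff ℝ ∞ f) (hg : ContDiff ℝ ∞ g) :
    posDeriv i (f - g) = posDeriv i f - posDeriv i g := by
  funext q
  simp [posDeriv, fderiv_sub (hf.differentiable (by simp) q) (hg.differentiable (by simp) q)]

lemma posDeriv_mul (i : Fin 2) {f g : Plane → ℝ} (hf : ContDiff ℝ ∞ f) (hg : ContDiff ℝ ∞ g) :
    posDeriv i (f * g) = f * posDeriv i g + g * posDeriv i f := by
  funext q
  simp [posDeriv, fderiv_mul (hf.differentiable (by simp) q) (hg.differentiable (by simp) q)]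

lemma posDeriv_cos (i : Fin 2) {θ : Plane → ℝ} (hθ : ContDiff ℝ ∞ θ) :
    posDeriv i (fun q => Real.cos (θ q)) = -(posDeriv i θ * fun q => Real.sin (θ q)) := by
  funext q
  simp [posDeriv, fderiv_cos (hθ.differentiable (by simp) q), mul_comm]

lemma posDeriv_sin (i : Fin 2) {θ : Plane → ℝ} (hθ : ContDiff ℝ ∞ θ) :
    posDeriv i (fun q => Real.sin (θ q)) = posDeriv i θ * fun q => Real.cos (θ q) := by
  funext q
  simp [posDeriv, fderiv_sin (hθ.differentiable (by simp) q), mul_comm]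

lemma posDeriv_mul_add_mul (i : Fin 2) {f g u v : Plane → ℝ} (hf : ContDiff ℝ ∞ f)
    (hu : ContDiff ℝ ∞ u) (hg : ContDiff ℝ ∞ g) (hv : ContDiff ℝ ∞ v) :
    posDeriv i (f * u + g * v) =
      f * posDeriv i u + u * posDeriv i f + (g * posDeriv i v + v * posDeriv i g) :=
  (posDeriv_add i (hf.mul hu) (hg.mul hv)).trans <|
    congrArg₂ (· + ·) (posDeriv_mul i hf hu) (posDeriv_mul i hg hv)

lemma posDeriv_mul_sub_mul (i : Fin 2) {f g u v : Plane → ℝ} (hf : ContDiff ℝ ∞ f)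
    (hu : ContDiff ℝ ∞ u) (hg : ContDiff ℝ ∞ g) (hv : ContDiff ℝ ∞ v) :
    posDeriv i (f * u - g * v) =
      f * posDeriv i u + u * posDeriv i f - (g * posDeriv i v + v * posDeriv i g) :=
  (posDeriv_sub i (hf.mul hu) (hg.mul hv)).trans <|
    congrArg₂ (· - ·) (posDeriv_mul i hf hu) (posDeriv_mul i hg hv)

/-- The function `a_α`. -/
def potentialA (ρ θ : Plane → ℝ) (α : ℕ × ℕ) : Plane → ℝ :=
  (fun q => Real.cos (θ q)) * traceCoeff (ρ * fun q => Real.cos (θ q)) α +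
    (fun q => Real.sin (θ q)) * traceCoeff (ρ * fun q => Real.sin (θ q)) α

/-- The function `b_α`. -/
def potentialB (ρ θ : Plane → ℝ) (α : ℕ × ℕ) : Plane → ℝ :=
  (fun q => Real.sin (θ q)) * traceCoeff (ρ * fun q => Real.cos (θ q)) α -
    (fun q => Real.cos (θ q)) * traceCoeff (ρ * fun q => Real.sin (θ q)) α

lemma coefficientRecursion_potential {ρ θ : Plane → ℝ} (hρ : ContDiff ℝ ∞ ρ)
    (hθ : ContDiff ℝ ∞ θ) : CoefficientRecursion ρ θ (potentialA ρ θ) (potentialB ρ θ) := by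
  have hc : ContDiff ℝ ∞ fun q => Real.cos (θ q) := hθ.cos
  have hs : ContDiff ℝ ∞ fun q => Real.sin (θ q) := hθ.sin
  have hρc : ContDiff ℝ ∞ (ρ * fun q => Real.cos (θ q)) := hρ.mul hc
  have hρs : ContDiff ℝ ∞ (ρ * fun q => Real.sin (θ q)) := hρ.mul hs
  have hF := contDiff_traceCoeff hρc
  have hG := contDiff_traceCoeff hρs
  -- The derivative that falls on the frame functions cos θ and sin θ is cancelled by the term with
  -- b_α; what is left is the frame component of the next derivative of ρσ_z.
  have hA : ∀ i α, posDeriv i (potentialA ρ θ α) + posDeriv i θ * potentialB ρ θ α =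
      (fun q => Real.cos (θ q)) * posDeriv i (traceCoeff (ρ * fun q => Real.cos (θ q)) α) +
        (fun q => Real.sin (θ q)) *
          posDeriv i (traceCoeff (ρ * fun q => Real.sin (θ q)) α) := by
    intro i α
    simp only [potentialA, potentialB]
    rw [posDeriv_mul_add_mul i hc (hF α) hs (hG α), posDeriv_cos i hθ, posDeriv_sin i hθ]
    ring
  have hB : ∀ i α, posDeriv i (potentialB ρ θ α) - posDeriv i θ * potentialA ρ θ α =
      (fun q => Real.sin (θ q)) * posDeriv i (traceCoeff (ρ * fun q => Real.cos (θ q)) α) -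
        (fun q => Real.cos (θ q)) *
          posDeriv i (traceCoeff (ρ * fun q => Real.sin (θ q)) α) := by
    intro i α
    simp only [potentialA, potentialB]
    rw [posDeriv_mul_sub_mul i hs (hF α) hc (hG α), posDeriv_cos i hθ, posDeriv_sin i hθ]
    ring
  refine ⟨?_, ?_, fun m n => ?_, fun m n => ?_, fun m n => ?_, fun m n => ?_⟩
  · funext q
    simp only [potentialA, traceCoeff, Function.iterate_zero, id, Pi.add_apply, Pi.mul_apply]
    linear_combination ρ q * Real.sin_sq_add_cos_sq (θ q)
  · funext q
    simp only [potentialB, traceCoeff, Function.iterate_zero, id, Pi.sub_apply, Pi.mul_apply,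
      Pi.zero_apply]
    ring
  · rw [hA, potentialA, traceCoeff_succ_left, traceCoeff_succ_left]
  · rw [hB, potentialB, traceCoeff_succ_left, traceCoeff_succ_left]
  · rw [hA, potentialA, traceCoeff_succ_right hρc, traceCoeff_succ_right hρs]
  · rw [hB, potentialB, traceCoeff_succ_right hρc, traceCoeff_succ_right hρs]

/-! ### From the given functions to the algebraic data and back -/

/-- The two-level system of the functions `ρ, θ, d`. -/
def twoLevel (ρ θ d : Plane → ℝ) (hρ : ContDiff ℝ ∞ ρ) (hθ : ContDiff ℝ ∞ θ)
    (hd : ContDiff ℝ ∞ d) (hρ_pos : ∀ q, 0 < ρ q) : TwoLevelData where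
  c := posSymbol (fun q => Real.cos (θ q / 2)) (hθ.div_const 2).cos
  s := posSymbol (fun q => Real.sin (θ q / 2)) (hθ.div_const 2).sin
  ρ := posSymbol ρ hρ
  g := posSymbol (fun q => 1 / (2 * ρ q))
    (contDiff_const.div (contDiff_const.mul hρ) fun q => by have := hρ_pos q; positivity)
  d := posSymbol d hd
  star_c := star_posSymbol _ _
  star_s := star_posSymbol _ _
  star_ρ := star_posSymbol _ _
  star_g := star_posSymbol _ _
  star_d := star_posSymbol _ _
  sq_add_sq := by
    ext z
    have h := Real.cos_sq_add_sin_sq (θ z.2 / 2)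
    simp only [map_add, map_mul, map_one, coe_posSymbol, onQ, Pi.add_apply, Pi.mul_apply,
      Pi.one_apply]
    rw [← sq, ← sq]
    exact_mod_cast h
  gap := by
    ext z
    have h : (ρ z.2 : ℂ) ≠ 0 := mod_cast (hρ_pos z.2).ne'
    simp only [map_mul, map_one, map_ofNat, coe_posSymbol, onQ, Pi.mul_apply,
      Pi.ofNat_apply]
    push_cast
    field_simp

section Bridge

variable {ρ θ d : Plane → ℝ} (hρ : ContDiff ℝ ∞ ρ) (hθ : ContDiff ℝ ∞ θ)
    (hd : ContDiff ℝ ∞ d) (hρ_pos : ∀ q, 0 < ρ q)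

local notation "𝔇" => twoLevel ρ θ d hρ hθ hd hρ_pos

lemma twoLevel_rho : TwoLevelData.ρ 𝔇 = posSymbol ρ hρ := rfl

lemma twoLevel_d : TwoLevelData.d 𝔇 = posSymbol d hd := rfl

lemma cosine_twoLevel : TwoLevelData.cosine 𝔇 = posSymbol (fun q => Real.cos (θ q)) hθ.cos := by
  ext z
  have h := Real.cos_two_mul' (θ z.2 / 2)
  rw [mul_div_cancel₀ _ two_ne_zero] at h
  simp only [TwoLevelData.cosine, twoLevel, map_sub, map_mul, coe_posSymbol, onQ, Pi.sub_apply,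
    Pi.mul_apply, h]
  push_cast
  ring

lemma sine_twoLevel : TwoLevelData.sine 𝔇 = posSymbol (fun q => Real.sin (θ q)) hθ.sin := by
  ext z
  have h := Real.sin_two_mul (θ z.2 / 2)
  rw [mul_div_cancel₀ _ two_ne_zero] at h
  simp only [TwoLevelData.sine, twoLevel, map_mul, map_ofNat, coe_posSymbol, onQ, Pi.mul_apply,
    Pi.ofNat_apply, h]
  push_cast
  ring

lemma map_hamiltonianM :
    (TwoLevelData.hamiltonianM 𝔇).map SmoothSymbol.val = hamiltonian ρ θ d := by
  refine Matrix.ext fun i j => funext fun z => ?_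
  fin_cases i <;> fin_cases j <;>
    simp [TwoLevelData.hamiltonianM, hamiltonian, frame, cosine_twoLevel, sine_twoLevel,
      coe_kineticEnergy, twoLevel_rho, twoLevel_d, onQ] <;> ring

lemma map_principal :
    (TwoLevelData.principal 𝔇).map SmoothSymbol.val = (1 / 2 : ℂ) • (1 + sigmaZ θ) := by
  refine Matrix.ext fun i j => funext fun z => ?_
  fin_cases i <;> fin_cases j <;>
    simp [TwoLevelData.principal, TwoLevelData.half, frame, cosine_twoLevel, sine_twoLevel,
      sigmaZ, onQ] <;> ring

lemma map_frameR : (TwoLevelData.frameR 𝔇).map SmoothSymbol.val = adiabaticFrame θ := by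
  refine Matrix.ext fun i j => funext fun z => ?_
  fin_cases i <;> fin_cases j <;>
    simp [TwoLevelData.frameR, planeRotation, twoLevel, adiabaticFrame, onQ]

lemma map_diagonal : (TwoLevelData.diagonal 𝔇).map SmoothSymbol.val =
    !![kinetic + onQ d + onQ ρ, 0; 0, kinetic + onQ d - onQ ρ] := by
  refine Matrix.ext fun i j => funext fun z => ?_
  fin_cases i <;> fin_cases j <;>
    simp [TwoLevelData.diagonal, twoLevel_rho, twoLevel_d, onQ, coe_kineticEnergy]

lemma toSeries_apply_eq (A : FormalMatrix) (k : ℕ) :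
    toSeries A k = (coeffM k A).map SmoothSymbol.val := rfl

lemma map_val_injective : Function.Injective fun A : SmoothMatrix => A.map SmoothSymbol.val :=
  fun _ _ h => Matrix.ext fun i j => SmoothSymbol.val_injective (congrFun (congrFun h i) j)

lemma toSeries_one : toSeries 1 = constSeries 1 := by
  rw [← const_one, toSeries_const]
  congr 1
  refine Matrix.ext fun i j => ?_
  by_cases h : i = j <;> simp [Matrix.one_apply, h]

/-- The smoothness clause is automatic on the image of `toSeries`, and the remaining clauses
transfer because `toSeries` is injective and turns products into `starProd`. -/
lemma isSuperadiabaticProjection_toSeries_iff (P : FormalMatrix) :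
    IsSuperadiabaticProjection ρ θ d (toSeries P) ↔
      IsProjection (const (TwoLevelData.hamiltonianM 𝔇)) (TwoLevelData.principal 𝔇) P := by
  constructor
  · rintro ⟨-, h₁, h₂, h₃⟩
    refine ⟨map_val_injective ?_, toSeries_injective ?_, toSeries_injective ?_⟩
    · exact h₁.trans (map_principal hρ hθ hd hρ_pos).symm
    · rw [toSeries_mul, h₂]
    · rw [toSeries_mul, toSeries_mul, toSeries_const, map_hamiltonianM, h₃]
  · rintro ⟨h₁, h₂, h₃⟩
    refine ⟨toSeries_smooth P, ?_, ?_, ?_⟩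
    · rw [toSeries_apply_eq, h₁, map_principal]
    · rw [← toSeries_mul, h₂]
    · rw [← map_hamiltonianM hρ hθ hd hρ_pos, ← toSeries_const, ← toSeries_mul, ← toSeries_mul, h₃]

lemma toSeries_eq_constSeries_one_iff (A : FormalMatrix) (k : ℕ) :
    toSeries A k = constSeries 1 k ↔ coeffM k (A - 1) = 0 := by
  rw [← toSeries_one, toSeries_apply_eq, toSeries_apply_eq, map_sub, sub_eq_zero]
  exact map_val_injective.eq_iff

lemma toSeries_entry_eq_zero_iff (A : FormalMatrix) (k : ℕ) (i j : Fin 2) :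
    toSeries A k i j = 0 ↔ coeffM k A i j = 0 :=
  map_eq_zero_iff SmoothSymbol.val SmoothSymbol.val_injective

lemma isSuperadiabaticUnitary_toSeries_iff (P U : FormalMatrix) (n : ℕ) :
    IsSuperadiabaticUnitary θ (toSeries P) n (toSeries U) ↔
      coeffM 0 U = TwoLevelData.frameR 𝔇 ∧ VanishesBelow (n + 2) (U * star U - 1) ∧
        VanishesBelow (n + 2) (star U * U - 1) ∧
        DiagonalBelow (n + 2) (U * trunc n P * star U) := by
  have key : IsSuperadiabaticUnitary θ (toSeries P) n (toSeries U) ↔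
      toSeries U 0 = adiabaticFrame θ ∧
      (∀ k ≤ n + 1, toSeries (U * star U) k = constSeries 1 k) ∧
      (∀ k ≤ n + 1, toSeries (star U * U) k = constSeries 1 k) ∧
      ∀ k ≤ n + 1, ∀ i j, i ≠ j → toSeries (U * trunc n P * star U) k i j = 0 := by
    simp only [toSeries_mul, toSeries_star, toSeries_trunc]
    exact ⟨fun h => ⟨h.2, h.3, h.4, h.5⟩, fun h => ⟨toSeries_smooth U, h.1, h.2.1, h.2.2.1, h.2.2.2⟩⟩
  rw [key]
  refine and_congr ?_ (and_congr ?_ (and_congr ?_ ?_))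
  · rw [← map_frameR hρ hθ hd hρ_pos]
    exact map_val_injective.eq_iff
  · exact forall_congr' fun k => imp_congr Nat.lt_succ_iff.symm (toSeries_eq_constSeries_one_iff _ _)
  · exact forall_congr' fun k => imp_congr Nat.lt_succ_iff.symm (toSeries_eq_constSeries_one_iff _ _)
  · refine forall_congr' fun k => imp_congr Nat.lt_succ_iff.symm ?_
    simp only [toSeries_entry_eq_zero_iff, Fin.forall_fin_two]
    simp

lemma frameSeries_val (x y z w : ℕ → SmoothSymbol) (k : ℕ) :
    frameSeries θ (fun k => (x k : ScalarSymbol)) (fun k => (y k : ScalarSymbol))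
      (fun k => (z k : ScalarSymbol)) (fun k => (w k : ScalarSymbol)) k =
    (frame (TwoLevelData.cosine 𝔇) (TwoLevelData.sine 𝔇) (x k) (y k) (z k) (w k)).map
      SmoothSymbol.val := by
  refine Matrix.ext fun i j => funext fun v => ?_
  fin_cases i <;> fin_cases j <;>
    simp [frameSeries, frame, sigmaX, sigmaY, sigmaZ, cosine_twoLevel, sine_twoLevel, onQ] <;> ring

lemma frameSeries_comp (P : FormalMatrix) :
    frameSeries θ
      (fun k => (compX (TwoLevelData.cosine 𝔇) (TwoLevelData.sine 𝔇) (coeffM k P) : ScalarSymbol))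
      (fun k => (compY (coeffM k P) : ScalarSymbol))
      (fun k => (compZ (TwoLevelData.cosine 𝔇) (TwoLevelData.sine 𝔇) (coeffM k P) : ScalarSymbol))
      (fun k => (compW (coeffM k P) : ScalarSymbol)) = toSeries P := by
  funext k
  rw [frameSeries_val hρ hθ hd hρ_pos, frame_comp (TwoLevelData.cosine_sq_add_sine_sq 𝔇),
    toSeries_apply_eq]

lemma coe_coeffA (α : ℕ × ℕ) :
    (coeffA (TwoLevelData.cosine 𝔇) (TwoLevelData.sine 𝔇) (posSymbol ρ hρ) α : ScalarSymbol) =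
      onQ (potentialA ρ θ α) := by
  have hc : ContDiff ℝ ∞ (ρ * fun q => Real.cos (θ q)) := hρ.mul hθ.cos
  have hs : ContDiff ℝ ∞ (ρ * fun q => Real.sin (θ q)) := hρ.mul hθ.sin
  have h₁ : posSymbol ρ hρ * posSymbol _ hθ.cos = posSymbol _ hc := by ext z; simp [onQ]
  have h₂ : posSymbol ρ hρ * posSymbol _ hθ.sin = posSymbol _ hs := by ext z; simp [onQ]
  rw [coeffA, cosine_twoLevel, sine_twoLevel, h₁, h₂, multiQ_posSymbol, multiQ_posSymbol]
  funext z
  simp [potentialA, onQ]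

lemma coe_coeffB (α : ℕ × ℕ) :
    (coeffB (TwoLevelData.cosine 𝔇) (TwoLevelData.sine 𝔇) (posSymbol ρ hρ) α : ScalarSymbol) =
      onQ (potentialB ρ θ α) := by
  have hc : ContDiff ℝ ∞ (ρ * fun q => Real.cos (θ q)) := hρ.mul hθ.cos
  have hs : ContDiff ℝ ∞ (ρ * fun q => Real.sin (θ q)) := hρ.mul hθ.sin
  have h₁ : posSymbol ρ hρ * posSymbol _ hθ.cos = posSymbol _ hc := by ext z; simp [onQ]
  have h₂ : posSymbol ρ hρ * posSymbol _ hθ.sin = posSymbol _ hs := by ext z; simp [onQ]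
  rw [coeffB, cosine_twoLevel, sine_twoLevel, h₁, h₂, multiQ_posSymbol, multiQ_posSymbol]
  funext z
  simp [potentialB, onQ]

lemma transportS_cosine : transportS (TwoLevelData.cosine 𝔇) =
    -(TwoLevelData.sine 𝔇 * transportS (posSymbol θ hθ)) := by
  rw [cosine_twoLevel, sine_twoLevel]
  ext z
  simp [transportS, derivQ_posSymbol, posDeriv_cos _ hθ, onQ]
  ring

lemma transportS_sine : transportS (TwoLevelData.sine 𝔇) =
    TwoLevelData.cosine 𝔇 * transportS (posSymbol θ hθ) := by
  rw [cosine_twoLevel, sine_twoLevel]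
  ext z
  simp [transportS, derivQ_posSymbol, posDeriv_sin _ hθ, onQ]
  ring

lemma coe_multiQ_posSymbol (α : ℕ × ℕ) :
    (multiQ α (posSymbol d hd) : ScalarSymbol) = onQ (traceCoeff d α) := by
  rw [multiQ_posSymbol, coe_posSymbol]

lemma toSeries_transformed (U : FormalMatrix) :
    transformedHamiltonian ρ θ d (toSeries U) =
      toSeries (U * const (TwoLevelData.hamiltonianM 𝔇) * star U) := by
  rw [transformedHamiltonian, toSeries_mul, toSeries_mul, toSeries_star, toSeries_const,
    map_hamiltonianM]

end Bridge

end

/-! ### Assembly of the theorem -/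

theorem lemma1 (ρ θ d : Plane → ℝ) (hρ : ContDiff ℝ ∞ ρ) (hθ : ContDiff ℝ ∞ θ)
    (hd : ContDiff ℝ ∞ d) (hρ_pos : ∀ q, 0 < ρ q) :
    ∃ (x y z w : ℕ → ScalarSymbol) (a b : ℕ × ℕ → Plane → ℝ),
      -- `x_n, y_n, z_n, w_n` are the components of the unique superadiabatic projection
      (∀ π : SymbolSeries,
        IsSuperadiabaticProjection ρ θ d π ↔ π = frameSeries θ x y z w) ∧
      -- superadiabatic representations exist to every order
      (∀ n : ℕ, ∃ U : SymbolSeries,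
        IsSuperadiabaticUnitary θ (frameSeries θ x y z w) n U) ∧
      -- the coupling symbols `κ_{n+1}^±`
      (∀ (n : ℕ) (U : SymbolSeries),
        IsSuperadiabaticUnitary θ (frameSeries θ x y z w) n U →
          transformedHamiltonian ρ θ d U 0 =
            !![kinetic + onQ d + onQ ρ, 0; 0, kinetic + onQ d - onQ ρ] ∧
          (∀ k ≤ n, transformedHamiltonian ρ θ d U k 0 1 = 0 ∧
            transformedHamiltonian ρ θ d U k 1 0 = 0) ∧
          transformedHamiltonian ρ θ d U (n + 1) 0 1 =
            (-2 : ℂ) • (onQ ρ * (x (n + 1) + y (n + 1))) ∧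
          transformedHamiltonian ρ θ d U (n + 1) 1 0 =
            (-2 : ℂ) • (onQ ρ * (x (n + 1) - y (n + 1)))) ∧
      -- initial terms
      x 1 = 0 ∧ z 1 = 0 ∧ w 1 = 0 ∧
      y 1 = (fun v => -(Complex.I / (4 * (ρ v.2 : ℂ))) *
        ((v.1 0 : ℂ) * (posDeriv 0 θ v.2 : ℂ) + (v.1 1 : ℂ) * (posDeriv 1 θ v.2 : ℂ))) ∧
      -- parity
      (∀ n, 1 ≤ n → Even n → y n = 0) ∧
      (∀ n, Odd n → x n = 0 ∧ z n = 0 ∧ w n = 0) ∧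
      -- recursions
      CoefficientRecursion ρ θ a b ∧
      (∀ n, Odd n →
        x (n + 1) = onQ (fun q => -(1 / (2 * ρ q))) *
          ((1 / Complex.I) • transport (y n) -
            (2 : ℂ) • momentumSum n (fun j α =>
              onQ (b α) * z (n + 1 - j) - onQ (a α) * x (n + 1 - j) +
                onQ (traceCoeff d α) * y (n + 1 - j)))) ∧
      (∀ n, 1 ≤ n → Even n →
        y (n + 1) = onQ (fun q => -(1 / (2 * ρ q))) *
          ((1 / Complex.I) • (transport (x n) - z n * transport (onQ θ)) -
            (2 : ℂ) • momentumSum n (fun j α =>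
              -(onQ (a α) * y (n + 1 - j)) + onQ (b α) * w (n + 1 - j) +
                onQ (traceCoeff d α) * x (n + 1 - j)))) ∧
      (∀ n, 1 ≤ n → Even n →
        (1 / Complex.I) • (transport (z n) + x n * transport (onQ θ)) =
          (2 : ℂ) • momentumSum n (fun j α =>
            onQ (b α) * y (n + 1 - j) + onQ (a α) * w (n + 1 - j) +
              onQ (traceCoeff d α) * z (n + 1 - j))) ∧
      (∀ n, 1 ≤ n → Even n →
        (1 / Complex.I) • transport (w n) =
          (2 : ℂ) • momentumSum n (fun j α =>
            onQ (a α) * z (n + 1 - j) + onQ (b α) * x (n + 1 - j) +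
              onQ (traceCoeff d α) * w (n + 1 - j))) := by
  set D := twoLevel ρ θ d hρ hθ hd hρ_pos with hD
  obtain ⟨P, hP⟩ := D.exists_isProjection
  have hcs := D.cosine_sq_add_sine_sq
  let x : ℕ → SmoothSymbol := fun k => compX D.cosine D.sine (FormalMatrix.coeffM k P)
  let y : ℕ → SmoothSymbol := fun k => compY (FormalMatrix.coeffM k P)
  let z : ℕ → SmoothSymbol := fun k => compZ D.cosine D.sine (FormalMatrix.coeffM k P)
  let w : ℕ → SmoothSymbol := fun k => compW (FormalMatrix.coeffM k P)
  have hframe : frameSeries θ (fun k => (x k : ScalarSymbol)) (fun k => (y k : ScalarSymbol))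
      (fun k => (z k : ScalarSymbol)) (fun k => (w k : ScalarSymbol)) = FormalMatrix.toSeries P :=
    frameSeries_comp hρ hθ hd hρ_pos P
  have hPk : ∀ k, FormalMatrix.coeffM k P = frame D.cosine D.sine (x k) (y k) (z k) (w k) := fun k =>
    (frame_comp hcs _).symm
  have hodd : ∀ k, Odd k → x k = 0 ∧ z k = 0 ∧ w k = 0 := fun k hk =>
    TwoLevelData.comp_projection_odd hP hk
  have heven : ∀ k, Even k → y k = 0 := fun k hk => TwoLevelData.compY_projection_even hP hk
  have hx₀ : x 0 = 0 := by
    simp only [x, hP.principal, TwoLevelData.principal, compX_frame hcs]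
  have hz₀ : z 0 = TwoLevelData.half := by
    simp only [z, hP.principal, TwoLevelData.principal, compZ_frame hcs]
  have hw₀ : w 0 = TwoLevelData.half := by
    simp only [w, hP.principal, TwoLevelData.principal, compW_frame]
  have hc : MomentumFree D.cosine := by
    rw [hD, cosine_twoLevel]; exact momentumFree_posSymbol _ _
  have hs : MomentumFree D.sine := by
    rw [hD, sine_twoLevel]; exact momentumFree_posSymbol _ _
  have hr : MomentumFree D.ρ := momentumFree_posSymbol ρ hρ
  have hdd : MomentumFree D.d := momentumFree_posSymbol d hd
  have htc : transportS D.cosine = -(D.sine * transportS (posSymbol θ hθ)) :=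
    transportS_cosine hρ hθ hd hρ_pos
  have hts : transportS D.sine = D.cosine * transportS (posSymbol θ hθ) :=
    transportS_sine hρ hθ hd hρ_pos
  have hxf : MomentumFree (x 0) := by rw [hx₀]; exact .zero
  have hzf : MomentumFree (z 0) := by rw [hz₀]; exact .smul _ .one
  have hwf : MomentumFree (w 0) := by rw [hw₀]; exact .smul _ .one
  -- The x and y recursions determine the new coefficient only through 2ρ times it; g = 1/(2ρ)
  -- solves for it.
  have hsolve : ∀ {a b m : SmoothSymbol}, a = (2 : ℂ) • (-(D.ρ * b) + m) →
      b = -D.g * (a - (2 : ℂ) • m) := by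
    intro a b m h
    rw [h, smul_add, add_sub_cancel_right, two_smul]
    linear_combination -b * D.gap
  have hg : ((-D.g : SmoothSymbol) : ScalarSymbol) = onQ fun q => -(1 / (2 * ρ q)) := by
    funext v
    simp [hD, twoLevel, onQ]
  have hA : ∀ α, (coeffA D.cosine D.sine D.ρ α : ScalarSymbol) = onQ (potentialA ρ θ α) :=
    coe_coeffA hρ hθ hd hρ_pos
  have hB : ∀ α, (coeffB D.cosine D.sine D.ρ α : ScalarSymbol) = onQ (potentialB ρ θ α) :=
    coe_coeffB hρ hθ hd hρ_pos
  have hC : ∀ α, (multiQ α D.d : ScalarSymbol) = onQ (traceCoeff d α) :=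
    coe_multiQ_posSymbol hd
  have hT : ∀ a b : SmoothSymbol, a = b → (a : ScalarSymbol) = b := fun _ _ h => h ▸ rfl
  refine ⟨fun k => x k, fun k => y k, fun k => z k, fun k => w k, potentialA ρ θ, potentialB ρ θ,
    fun π => ?_, fun n => ?_, fun n U hU => ?_, ?_, ?_, ?_, ?_, fun n _ hn => ?_, fun n hn => ?_,
    coefficientRecursion_potential hρ hθ, fun n hn => ?_, fun n _ hn => ?_, fun n _ hn => ?_,
    fun n _ hn => ?_⟩
  · rw [hframe]
    constructor
    · intro h
      obtain ⟨Q, rfl⟩ := FormalMatrix.exists_toSeries_eq h.smooth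
      rw [isSuperadiabaticProjection_toSeries_iff hρ hθ hd hρ_pos] at h
      rw [TwoLevelData.isProjection_unique hP h]
    · rintro rfl
      rwa [isSuperadiabaticProjection_toSeries_iff hρ hθ hd hρ_pos]
  · obtain ⟨U, hU₀, hUU, hUP⟩ := TwoLevelData.exists_superadiabatic hP n
    refine ⟨FormalMatrix.toSeries U, ?_⟩
    rw [hframe, isSuperadiabaticUnitary_toSeries_iff hρ hθ hd hρ_pos]
    exact ⟨hU₀, hUU, FormalMatrix.vanishesBelow_star_mul_self D.star_mul_frameR hU₀ hUU, hUP⟩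
  · obtain ⟨U, rfl⟩ := FormalMatrix.exists_toSeries_eq hU.smooth
    rw [hframe, isSuperadiabaticUnitary_toSeries_iff hρ hθ hd hρ_pos] at hU
    obtain ⟨hU₀, -, hUU, hUP⟩ := hU
    obtain ⟨h₁, h₂, h₃⟩ := TwoLevelData.superadiabatic_coupling hP hU₀ hUU hUP
    rw [toSeries_transformed hρ hθ hd hρ_pos]
    refine ⟨?_, fun k hk => ?_, ?_, ?_⟩
    · rw [toSeries_apply_eq, FormalMatrix.coeffM_zero_mul, FormalMatrix.coeffM_zero_mul, FormalMatrix.coeffM_star, hU₀, FormalMatrix.coeffM_const,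
        if_pos rfl, TwoLevelData.frameR_conj_hamiltonianM, map_diagonal]
    · rw [toSeries_entry_eq_zero_iff, toSeries_entry_eq_zero_iff]
      exact h₁ k (Nat.lt_succ_of_le hk)
    · refine (hT _ _ h₂).trans ?_
      simp only [map_smul, map_mul, map_add]
      rfl
    · refine (hT _ _ h₃).trans ?_
      simp only [map_smul, map_mul, map_sub]
      rfl
  · exact (hT _ _ (hodd 1 odd_one).1).trans (map_zero _)
  · exact (hT _ _ (hodd 1 odd_one).2.1).trans (map_zero _)
  · exact (hT _ _ (hodd 1 odd_one).2.2).trans (map_zero _)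
  -- The value of y_1 is the even recursion at n = 0, where the momentum sum is empty, x_0 = 0, and
  -- z_0 = 1/2 leaves only the rotation of the frame.
  · have h := hsolve (recursion_x hc hs hr hdd hcs htc hts hPk hP.commutes hxf hwf hodd heven
      (n := 0) (by simp))
    rw [hx₀, hz₀] at h
    refine (hT _ _ h).trans (funext fun v => ?_)
    have hv : (ρ v.2 : ℂ) ≠ 0 := mod_cast (hρ_pos v.2).ne'
    simp [momentumSumS, transportS, TwoLevelData.half, coe_momentum, derivQ_posSymbol, hD, twoLevel,
      onQ]
    field_simp
    ring
  · exact (hT _ _ (heven n hn)).trans (map_zero _)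
  · obtain ⟨h₁, h₂, h₃⟩ := hodd n hn
    exact ⟨(hT _ _ h₁).trans (map_zero _), (hT _ _ h₂).trans (map_zero _),
      (hT _ _ h₃).trans (map_zero _)⟩
  · have h := hT _ _ (hsolve (recursion_y hc hs hr hdd hcs htc hts hPk hP.commutes hxf hzf hodd
      heven hn))
    simpa only [map_mul, map_sub, map_smul, map_add, coe_momentumSumS, coe_transportS, hA, hB, hC,
      hg] using h
  · have h := hT _ _ (hsolve (recursion_x hc hs hr hdd hcs htc hts hPk hP.commutes hxf hwf hodd
      heven hn))
    simpa only [map_mul, map_sub, map_smul, map_add, map_neg (SmoothSymbol.val) (_ * _),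
      coe_momentumSumS, coe_transportS, hA, hB, hC, hg, coe_posSymbol] using h
  · have h := hT _ _ (recursion_z hc hs hr hdd hcs htc hts hPk hP.commutes hzf hwf hodd heven hn)
    simpa only [map_mul, map_smul, map_add, coe_momentumSumS, coe_transportS, hA, hB, hC,
      coe_posSymbol] using h
  · have h := hT _ _ (recursion_w hc hs hr hdd hcs htc hts hPk hP.commutes hxf hzf hwf hodd hn)
    simpa only [map_mul, map_smul, map_add, coe_momentumSumS, coe_transportS, hA, hB, hC] using h
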